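/- **Proposition (asymptotic convergence rates).** Let $d\ge 1$ and let $P_{\mathcal X}$ be a probability measure on $\mathbb R^d$ supported on a compact convex set $C$, with a density that is smooth and strictly positive on $C$. Let $0<p\le1$, $L_c>0$, $\sigma_\xi\ge0$, and fix hyperparameters $\hat\sigma_f^2>0$, $\hat\sigma_\xi^2>0$, $\hat\ell>0$ (and $\hat{\boldsymbol b}\in\mathbb R^{d_T}$ for NNGP). *Kernel and predictors.* Let $c$ be a continuous symmetric positive definite kernel on $\mathbb R^d$ with $c(x,x)=1$, which is a strictly decreasing function of $\|x-x'\|_2$ and satisfies $c(x,x')\ge 1-L_c\|x-x'\|_2^{2p}$. Put $\rho_c(x,x')=\sqrt{1-c(x/\hat\ell,x'/\hat\ell)}$. For covariates $x_1,\dots,x_n$ with responses $y_1,\dots,y_n$ and a test point $x_*$, let $x_{n,1},\dots,x_{n,m}$ be the $m$ nearest neighbours of $x_*$ with respect to $\rho_c$ (equivalently, to the Euclidean distance), in order of increasing distance, and let $y_{\mathcal N}$ be their responses. Let $[K_{\mathcal N}]_{ij}=\hat\sigma_f^2c(x_{n,i}/\hat\ell,x_{n,j}/\hat\ell)+\hat\sigma_\xi^2\delta_{ij}$,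 $[k^*_{\mathcal N}]_j=\hat\sigma_f^2c(x_*/\hat\ell,x_{n,j}/\hat\ell)$ and $\Gamma=\frac{\hat\sigma_\xi^2+m\hat\sigma_f^2}{m\hat\sigma_f^2}$. The GPnn predictor is $\tilde\mu(x_*)=\Gamma\,{k^*_{\mathcal N}}^TK_{\mathcal N}^{-1}y_{\mathcal N}$; the NNGP predictor, for a regressor map $\boldsymbol t:\mathbb R^d\to\mathbb R^{d_T}$, is $\tilde\mu(x_*)=\boldsymbol t(x_*)^T\hat{\boldsymbol b}+\Gamma\,{k^*_{\mathcal N}}^TK_{\mathcal N}^{-1}(y_{\mathcal N}-T_{\mathcal N}\hat{\boldsymbol b})$, where the rows of $T_{\mathcal N}$ are $\boldsymbol t(x_{n,j})^T$. *Responses.* The training covariates $\mathcal X_1,\dots,\mathcal X_n$ and the test covariate are i.i.d. from $P_{\mathcal X}$, and $\mathcal Y_i=g(\mathcal X_i)+\Xi_i$ with i.i.d. noise of mean zero and variance $\sigma_\xi^2$, independent of the covariates and of $g$. (GPnn) $g=f$ is deterministic with $|f|\le B_f$ and $|f(x)-f(x')|\le L_f\|x-x'\|_2^q$ on $\mathbb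 R^d$, where $B_f,L_f\ge1$ and $0<q\le1$. Put $\alpha=\min\{p,q\}$. (NNGP) $g=\boldsymbol t^T\boldsymbol b+w$, where $|t_i|\le B_T$ and $|t_i(x)-t_i(x')|\le L_i\|x-x'\|_2^{q_i}$ with $L_i\ge1$ and $0<q_i\le1$ for $i=1,\dots,d_T$, and $w$ is a (jointly measurable) Gaussian process with mean zero and covariance function $\tilde k$. Here $\tilde k(x,x)=\sigma_w^2>0$ for all $x$, and $\tilde c=\tilde k/\sigma_w^2$ satisfies $\tilde c(x,x')\ge1-L_{\tilde c}\|x-x'\|_2^{2q_0}$ with $L_{\tilde c},q_0>0$, and the (pseudo)metrics $\rho_c$ and $\rho_{\tilde c}=\sqrt{1-\tilde c}$ are equivalent, i.e. each is bounded by a constant multiple of the other. Put $\alpha=\min\{p,q_0,q_1,\dots,q_{d_T}\}$. In both cases let $\mathcal R_n=\mathbb E\big[\int(\tilde\mu(x)-g(x))^2\,dP_{\mathcal X}(x)\big]$, the expectation being over the training sample (and over $w$ for NNGP), and let the number of neighbours be $m_n=n^{2p/(2p+d)}$, rounded down or up to an integer. Then there are $0<A<\infty$ and $n_0$ such that $$\mathcal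 R_n\le A\,n^{-\frac{2\alpha}{2p+d}}\qquad\text{for all } n\ge n_0 .$$ Here $A$ and $n_0$ depend only on $P_{\mathcal X},d,p,L_c,\sigma_\xi$, the hyperparameters, and on $q,B_f,L_f$ for GPnn, respectively on $d_T,q_0,(q_i),(L_i),B_T,L_{\tilde c},\sigma_w^2,\boldsymbol b$ for NNGP. No relation between $d$ and $\alpha+p$ is required. -/

import Mathlib

open MeasureTheory ProbabilityTheory
open scoped ENNReal Matrix ContDiff

namespace LocalGP

/-- The covariate space: `ℝᵈ` with the Euclidean norm. -/
abbrev Cov (d : ℕ) : Type := EuclideanSpace ℝ (Fin d)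

/-! ### Kernels -/

/-- A continuous, symmetric, positive (semi)definite kernel on `ℝᵈ`, normalised to be `1` on the
diagonal. -/
structure IsNormalizedKernel {d : ℕ} (c : Cov d → Cov d → ℝ) : Prop where
  continuous : Continuous (Function.uncurry c)
  symm : ∀ x x', c x x' = c x' x
  posSemidef : ∀ (N : ℕ) (x : Fin N → Cov d),
    (Matrix.of fun i j => c (x i) (x j)).PosSemidef
  diag : ∀ x, c x x = 1

/-- The kernel is a strictly decreasing function of the Euclidean distance. -/
def IsStrictlyDecreasingIsotropic {d : ℕ} (c : Cov d → Cov d → ℝ) : Prop :=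
  ∃ φ : ℝ → ℝ, StrictAntiOn φ (Set.Ici 0) ∧ ∀ x x', c x x' = φ (dist x x')

/-- The lower bound `c(x, x') ≥ 1 - L ‖x - x'‖ ^ (2 s)`. -/
def HasHolderLowerBound {d : ℕ} (c : Cov d → Cov d → ℝ) (L s : ℝ) : Prop :=
  ∀ x x', 1 - L * dist x x' ^ (2 * s) ≤ c x x'

/-- The kernel-induced (pseudo)metric `√(1 - c(x / ℓ, x' / ℓ))`. -/
noncomputable def kernelMetric {d : ℕ} (c : Cov d → Cov d → ℝ) (ℓ : ℝ) (x x' : Cov d) : ℝ :=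
  √(1 - c (ℓ⁻¹ • x) (ℓ⁻¹ • x'))

/-- Equivalence of two (pseudo)metrics: each is bounded by a constant multiple of the other. -/
def EquivalentMetrics {E : Type*} (ρ₁ ρ₂ : E → E → ℝ) : Prop :=
  ∃ a C : ℝ, 0 < a ∧ a ≤ C ∧ ∀ x x', a * ρ₁ x x' ≤ ρ₂ x x' ∧ ρ₂ x x' ≤ C * ρ₁ x x'

/-! ### The predictors -/

/-- The hyperparameters: kernelscale `σ̂_f²`, noise variance `σ̂_ξ²`, lengthscale `ℓ̂`. -/
structure Hyperparameters where
  kernelScale : ℝ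
  noiseVar : ℝ
  lengthScale : ℝ
  kernelScale_pos : 0 < kernelScale
  noiseVar_pos : 0 < noiseVar
  lengthScale_pos : 0 < lengthScale

/-- The shifted Gram matrix `σ̂_f² c(x_i / ℓ̂, x_j / ℓ̂) + σ̂_ξ² δ_ij` of the points `x_1, …, x_m`. -/
noncomputable def shiftedGram {d m : ℕ} (c : Cov d → Cov d → ℝ) (θ : Hyperparameters)
    (x : Fin m → Cov d) : Matrix (Fin m) (Fin m) ℝ :=
  Matrix.of fun i j =>
    θ.kernelScale * c (θ.lengthScale⁻¹ • x i) (θ.lengthScale⁻¹ • x j)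
      + if i = j then θ.noiseVar else 0

/-- The vector `σ̂_f² c(x_* / ℓ̂, x_j / ℓ̂)`. -/
noncomputable def crossCov {d m : ℕ} (c : Cov d → Cov d → ℝ) (θ : Hyperparameters)
    (x : Fin m → Cov d) (xs : Cov d) : Fin m → ℝ :=
  fun j => θ.kernelScale * c (θ.lengthScale⁻¹ • xs) (θ.lengthScale⁻¹ • x j)

/-- The correction factor `Γ = (σ̂_ξ² + m σ̂_f²) / (m σ̂_f²)`. -/
noncomputable def gammaFactor (θ : Hyperparameters) (m : ℕ) : ℝ :=
  (θ.noiseVar + m * θ.kernelScale) / (m * θ.kernelScale)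

/-- `Γ k_*ᵀ K⁻¹ y` for the points `x_1, …, x_m` with values `y_1, …, y_m`. -/
noncomputable def correctedMean {d m : ℕ} (c : Cov d → Cov d → ℝ) (θ : Hyperparameters)
    (x : Fin m → Cov d) (y : Fin m → ℝ) (xs : Cov d) : ℝ :=
  gammaFactor θ m * (crossCov c θ x xs ⬝ᵥ ((shiftedGram c θ x)⁻¹ *ᵥ y))

/-- The indices of the `m` nearest neighbours of `xs` among `X_1, …, X_n` in the kernel-induced
metric, ordered by increasing distance (ties are broken by index). -/
noncomputable def nnIndex {d n m : ℕ} (c : Cov d → Cov d → ℝ) (θ : Hyperparameters) (hm : m ≤ n)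
    (X : Fin n → Cov d) (xs : Cov d) : Fin m → Fin n :=
  fun j => Tuple.sort (fun i => kernelMetric c θ.lengthScale xs (X i)) (Fin.castLE hm j)

/-- The `GPnn` predictive mean at `xs` from training covariates `X` and responses `Y`. -/
noncomputable def gpnnPredictor {d n m : ℕ} (c : Cov d → Cov d → ℝ) (θ : Hyperparameters)
    (hm : m ≤ n) (X : Fin n → Cov d) (Y : Fin n → ℝ) (xs : Cov d) : ℝ :=
  correctedMean c θ (fun j => X (nnIndex c θ hm X xs j)) (fun j => Y (nnIndex c θ hm X xs j)) xs

/-- The `NNGP` predictive mean at `xs`, with regressors `t` and estimated regression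
coefficients `bhat`. -/
noncomputable def nngpPredictor {d n m dT : ℕ} (c : Cov d → Cov d → ℝ) (θ : Hyperparameters)
    (t : Cov d → Fin dT → ℝ) (bhat : Fin dT → ℝ)
    (hm : m ≤ n) (X : Fin n → Cov d) (Y : Fin n → ℝ) (xs : Cov d) : ℝ :=
  t xs ⬝ᵥ bhat +
    correctedMean c θ (fun j => X (nnIndex c θ hm X xs j))
      (fun j => Y (nnIndex c θ hm X xs j) - t (X (nnIndex c θ hm X xs j)) ⬝ᵥ bhat) xs

/-! ### Risk -/

/-- The `L₂(P)`-risk `𝔼[∫ (ĝ_n(x) - g(x))² dP(x)]` of an estimator `est` of a fixed function `g`.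
The training sample consists of `n` i.i.d. pairs (covariate, noise) `Z_i` with law `P ⊗ Pξ`, and
the responses are `g (X_i) + Ξ_i`. The value lies in `[0, ∞]`. -/
noncomputable def risk {d n : ℕ} (P : Measure (Cov d)) (Pξ : Measure ℝ) (g : Cov d → ℝ)
    (est : (Fin n → Cov d) → (Fin n → ℝ) → Cov d → ℝ) : ℝ≥0∞ :=
  ∫⁻ Z : Fin n → Cov d × ℝ,
    (∫⁻ x, ENNReal.ofReal
      ((est (fun i => (Z i).1) (fun i => g (Z i).1 + (Z i).2) x - g x) ^ 2) ∂P)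
    ∂(Measure.pi fun _ => P.prod Pξ)

/-- The `GPnn` risk, for the response model `Y_i = f(X_i) + Ξ_i`. -/
noncomputable def gpnnRisk {d n m : ℕ} (P : Measure (Cov d)) (Pξ : Measure ℝ)
    (c : Cov d → Cov d → ℝ) (θ : Hyperparameters) (f : Cov d → ℝ) (hm : m ≤ n) : ℝ≥0∞ :=
  risk P Pξ f (gpnnPredictor (n := n) c θ hm)

/-- The `NNGP` risk, for the response model `Y_i = t(X_i)ᵀ b + w(X_i) + Ξ_i` with a random field
`w` independent of covariates and noise; the expectation is also over the field. -/
noncomputable def nngpRisk {d n m dT : ℕ} {Ω : Type*} [MeasurableSpace Ω]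
    (P : Measure (Cov d)) (Pξ : Measure ℝ) (Pw : Measure Ω)
    (c : Cov d → Cov d → ℝ) (θ : Hyperparameters)
    (t : Cov d → Fin dT → ℝ) (b bhat : Fin dT → ℝ) (w : Cov d → Ω → ℝ) (hm : m ≤ n) : ℝ≥0∞ :=
  ∫⁻ s, risk P Pξ (fun x => t x ⬝ᵥ b + w x s) (nngpPredictor (n := n) c θ t bhat hm) ∂Pw

/-! ### Assumptions on the data -/

/-- `P` is supported on a compact convex set `C` and has a density that is smooth and strictly
positive on `C`. -/
def HasSmoothPosDensityOnCompactConvex {d : ℕ} (P : Measure (Cov d)) : Prop :=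
  ∃ (C : Set (Cov d)) (ρ : Cov d → ℝ), IsCompact C ∧ Convex ℝ C ∧
    ContDiffOn ℝ ∞ ρ C ∧ (∀ x ∈ C, 0 < ρ x) ∧
    P = (volume.restrict C).withDensity fun x => ENNReal.ofReal (ρ x)

/-- `f` is bounded by `B` and Hölder continuous with exponent `q` and constant `L`. -/
def IsBoundedHolder {d : ℕ} (f : Cov d → ℝ) (B L q : ℝ) : Prop :=
  (∀ x, |f x| ≤ B) ∧ ∀ x x', |f x - f x'| ≤ L * dist x x' ^ q

/-- A noise law on `ℝ` with mean zero and variance `σ²`. -/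
structure IsNoiseLaw (Pξ : Measure ℝ) (σ : ℝ) : Prop where
  isProbabilityMeasure : IsProbabilityMeasure Pξ
  memLp : MemLp id 2 Pξ
  mean_zero : ∫ s, s ∂Pξ = 0
  variance_eq : Var[id; Pξ] = σ ^ 2

/-- `w` is a jointly measurable, mean-zero Gaussian process on `ℝᵈ` with covariance function
`k`. -/
structure IsCenteredGaussianField {d : ℕ} {Ω : Type*} [MeasurableSpace Ω] (Pw : Measure Ω)
    (w : Cov d → Ω → ℝ) (k : Cov d → Cov d → ℝ) : Prop where
  measurable : Measurable (Function.uncurry w)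
  isGaussianProcess : IsGaussianProcess w Pw
  mean_zero : ∀ x, ∫ s, w x s ∂Pw = 0
  covariance_eq : ∀ x x', cov[w x, w x'; Pw] = k x x'

/-- The exponent `α = min {p, q₀, q₁, …, q_{d_T}}`. -/
noncomputable def nngpExponent {dT : ℕ} (p q₀ : ℝ) (q : Fin dT → ℝ) : ℝ :=
  min p (Finset.univ.fold min q₀ q)

/-- `m` is one of the two roundings of `n ^ (2p / (2p + d))` to an integer. -/
def IsNeighbourCount (d : ℕ) (p : ℝ) (n m : ℕ) : Prop :=
  m = ⌊(n : ℝ) ^ (2 * p / (2 * p + d))⌋₊ ∨ m = ⌈(n : ℝ) ^ (2 * p / (2 * p + d))⌉₊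

end LocalGP

open LocalGP

namespace LocalGP

/-! For a fixed design the prediction is linear in the responses, with weights `w = Γ K⁻¹ k_*` that
involve neither responses nor noise. If the test point and its `m` neighbours lie so close together
that all their correlations are at least `1 - η`, then `w` is close to the uniform average. Two
estimates carry this: `m ‖w‖²` is bounded in terms of `m η` (`gpWeights_dotProduct_self_le`), and `∑
w - 1` is of order `η √(1 + m ‖w‖²)` (`gpWeights_sum_sub_one_sq_le`).

The error splits as `∑ w_j (g(X_j) - g(x)) + (∑ w_j - 1) g(x) + ∑ w_j Ξ_j`, and the mean squares of
the three terms are controlled by `m ‖w‖²` times the squared modulus of `g`, by `(∑ w - 1)²`, and by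
`σ² ‖w‖²`. Put `h = n^(-1/(2p+d))`, so that `m ≍ n h^d = h^(-2p)`. If the neighbours lie within a
constant times `u h`, where `u ≥ 1`, then `η` is at most of order `u² h^(2p)`, so `m η` is at most
of order `u²`, and all three terms are at most of order `h^(2α) u^8`.

It remains to bound the mean of `u^8`. Convexity of the support and positivity of the density give
every ball of radius `r` centred in the support a mass of order at least `r^d`. A Chernoff bound
then shows that fewer than `m` points fall within `2^k κ h` with probability at most `exp(-2^k)`,
which beats every power of `2^k` (`lintegral_spreadFactor_le`).

Both models are instances of one statement about a random field that is Hölder in mean square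
(`exists_risk_rate`): GPnn with a deterministic field, NNGP with the residual field `tᵀ(b - b̂) +
w`. -/

/-! ### Shifted Gram matrices and the weights of the predictor. -/

lemma IsNormalizedKernel.le_one {d : ℕ} {c : Cov d → Cov d → ℝ} (hc : IsNormalizedKernel c)
    (x x' : Cov d) : c x x' ≤ 1 := by
  have h := (hc.posSemidef 2 ![x, x']).dotProduct_mulVec_nonneg ![1, -1]
  have h1 := hc.diag x
  have h2 := hc.diag x'
  have h3 := hc.symm x x'
  simp [Matrix.mulVec, dotProduct, Fin.sum_univ_two] at h
  linarith

lemma shiftedGram_eq {d m : ℕ} (c : Cov d → Cov d → ℝ) (θ : Hyperparameters)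
    (x : Fin m → Cov d) :
    shiftedGram c θ x = θ.kernelScale • (Matrix.of fun i j =>
        c (θ.lengthScale⁻¹ • x i) (θ.lengthScale⁻¹ • x j)) +
      θ.noiseVar • (1 : Matrix (Fin m) (Fin m) ℝ) := by
  ext i j
  simp [shiftedGram, Matrix.one_apply]

lemma shiftedGram_posDef {d m : ℕ} {c : Cov d → Cov d → ℝ} (hc : IsNormalizedKernel c)
    (θ : Hyperparameters) (x : Fin m → Cov d) : (shiftedGram c θ x).PosDef := by
  rw [shiftedGram_eq]
  exact Matrix.PosDef.posSemidef_add
    ((hc.posSemidef m fun i => θ.lengthScale⁻¹ • x i).smul θ.kernelScale_pos.le)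
    (Matrix.PosDef.one.smul θ.noiseVar_pos)

lemma noiseVar_mul_le_quadratic {d m : ℕ} {c : Cov d → Cov d → ℝ} (hc : IsNormalizedKernel c)
    (θ : Hyperparameters) (x : Fin m → Cov d) (z : Fin m → ℝ) :
    θ.noiseVar * (z ⬝ᵥ z) ≤ z ⬝ᵥ (shiftedGram c θ x *ᵥ z) := by
  have h := ((hc.posSemidef m fun i => θ.lengthScale⁻¹ • x i).smul
    θ.kernelScale_pos.le).dotProduct_mulVec_nonneg z
  rw [shiftedGram_eq, Matrix.add_mulVec, dotProduct_add]
  simp only [star_trivial] at h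
  simp only [Matrix.smul_mulVec, Matrix.one_mulVec, dotProduct_smul, smul_eq_mul] at h ⊢
  linarith

/-- The weights with which the responses of the neighbours enter the predictive mean. -/
noncomputable def gpWeights {d m : ℕ} (c : Cov d → Cov d → ℝ) (θ : Hyperparameters)
    (x : Fin m → Cov d) (xs : Cov d) : Fin m → ℝ :=
  gammaFactor θ m • ((shiftedGram c θ x)⁻¹ *ᵥ crossCov c θ x xs)

lemma shiftedGram_transpose {d m : ℕ} {c : Cov d → Cov d → ℝ} (hc : IsNormalizedKernel c)
    (θ : Hyperparameters) (x : Fin m → Cov d) : (shiftedGram c θ x)ᵀ = shiftedGram c θ x := by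
  ext i j
  simp only [Matrix.transpose_apply, shiftedGram, Matrix.of_apply]
  rw [hc.symm]
  simp [eq_comm]

lemma correctedMean_eq_dotProduct {d m : ℕ} {c : Cov d → Cov d → ℝ} (hc : IsNormalizedKernel c)
    (θ : Hyperparameters) (x : Fin m → Cov d) (y : Fin m → ℝ) (xs : Cov d) :
    correctedMean c θ x y xs = gpWeights c θ x xs ⬝ᵥ y := by
  rw [correctedMean, gpWeights, smul_dotProduct, smul_eq_mul, Matrix.dotProduct_mulVec,
    ← Matrix.mulVec_transpose, Matrix.transpose_nonsing_inv, shiftedGram_transpose hc]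

lemma sq_sum_le_of_abs_le {m : ℕ} {s z : Fin m → ℝ} {η : ℝ} (hs : ∀ i, |s i| ≤ η) :
    (s ⬝ᵥ z) ^ 2 ≤ η ^ 2 * (m * (z ⬝ᵥ z)) := by
  have h := Finset.sum_mul_sq_le_sq_mul_sq Finset.univ s z
  have h2 : ∑ i, s i ^ 2 ≤ m * η ^ 2 := by
    calc ∑ i, s i ^ 2 ≤ ∑ _i : Fin m, η ^ 2 :=
          Finset.sum_le_sum fun i _ => by
            rw [← sq_abs]; exact pow_le_pow_left₀ (abs_nonneg _) (hs i) 2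
      _ = m * η ^ 2 := by simp
  have h3 : z ⬝ᵥ z = ∑ i, z i ^ 2 := by simp [dotProduct, sq]
  rw [h3]
  calc (s ⬝ᵥ z) ^ 2 ≤ (∑ i, s i ^ 2) * ∑ i, z i ^ 2 := h
    _ ≤ (m * η ^ 2) * ∑ i, z i ^ 2 := by gcongr
    _ = _ := by ring

/-- Stability of the solution of a shifted Gram system. -/
lemma dotProduct_self_le_of_shiftedGram_mulVec_eq {d m : ℕ} {c : Cov d → Cov d → ℝ}
    (hc : IsNormalizedKernel c) (θ : Hyperparameters) (x : Fin m → Cov d) {z r : Fin m → ℝ}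
    {η : ℝ} (hz : shiftedGram c θ x *ᵥ z = r) (hr : ∀ i, |r i| ≤ η) :
    θ.noiseVar ^ 2 * (z ⬝ᵥ z) ≤ m * η ^ 2 := by
  have h1 := noiseVar_mul_le_quadratic hc θ x z
  rw [hz, dotProduct_comm z r] at h1
  have h2 := sq_sum_le_of_abs_le (z := z) hr
  have h0 : 0 ≤ z ⬝ᵥ z := by simpa using dotProduct_star_self_nonneg z
  -- Coercivity and Cauchy–Schwarz bound the square of `noiseVar * (z ⬝ᵥ z)` by a multiple of `z ⬝ᵥ
  -- z`; one factor `z ⬝ᵥ z` is then cancelled.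
  rcases h0.eq_or_lt with h0 | h0
  · rw [← h0]; simp; positivity
  · have h3 : (θ.noiseVar * (z ⬝ᵥ z)) ^ 2 ≤ η ^ 2 * (m * (z ⬝ᵥ z)) :=
      (pow_le_pow_left₀ (mul_nonneg θ.noiseVar_pos.le h0.le) h1 2).trans h2
    refine le_of_mul_le_mul_right ?_ h0
    calc _ = (θ.noiseVar * (z ⬝ᵥ z)) ^ 2 := by ring
      _ ≤ _ := h3
      _ = _ := by ring

/-- If all correlations were 1, constant vectors would be eigenvectors with eigenvalue `noiseVar + m
* kernelScale`. The subtracted sum measures how far a row is from this ideal case. -/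
lemma shiftedGram_mulVec_const {d m : ℕ} (c : Cov d → Cov d → ℝ) (θ : Hyperparameters)
    (x : Fin m → Cov d) (t : ℝ) (i : Fin m) :
    (shiftedGram c θ x *ᵥ fun _ => t) i = t * (θ.noiseVar + m * θ.kernelScale -
      θ.kernelScale * (∑ j, (1 - c (θ.lengthScale⁻¹ • x i) (θ.lengthScale⁻¹ • x j)))) := by
  simp only [Matrix.mulVec, dotProduct, shiftedGram, Matrix.of_apply, ← Finset.sum_mul,
    Finset.sum_add_distrib, Finset.sum_ite_eq, Finset.mem_univ, if_true, Finset.sum_sub_distrib,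
    ← Finset.mul_sum]
  simp
  ring

/-! ### Weights for a tight cluster of neighbours. -/

section WeightBounds

variable {d m : ℕ} {c : Cov d → Cov d → ℝ} (hc : IsNormalizedKernel c) (θ : Hyperparameters)
  (hm : 0 < m) {x : Fin m → Cov d} {xs : Cov d} {η : ℝ}
  (hx : ∀ i j, 1 - η ≤ c (θ.lengthScale⁻¹ • x i) (θ.lengthScale⁻¹ • x j))
  (hxs : ∀ j, 1 - η ≤ c (θ.lengthScale⁻¹ • xs) (θ.lengthScale⁻¹ • x j))

include hc hm hx

lemma meanDefect_nonneg_and_le (i : Fin m) :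
    0 ≤ θ.kernelScale * (∑ j, (1 - c (θ.lengthScale⁻¹ • x i) (θ.lengthScale⁻¹ • x j))) /
        (θ.noiseVar + m * θ.kernelScale) ∧
    θ.kernelScale * (∑ j, (1 - c (θ.lengthScale⁻¹ • x i) (θ.lengthScale⁻¹ • x j))) /
        (θ.noiseVar + m * θ.kernelScale) ≤ η := by
  have ha := θ.kernelScale_pos
  have hl := θ.noiseVar_pos
  have hη : 0 ≤ η := by
    have := hx ⟨0, hm⟩ ⟨0, hm⟩
    rw [hc.diag] at this; linarith
  have h0 : 0 ≤ ∑ j, (1 - c (θ.lengthScale⁻¹ • x i) (θ.lengthScale⁻¹ • x j)) :=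
    Finset.sum_nonneg fun j _ => by linarith [hc.le_one (θ.lengthScale⁻¹ • x i) (θ.lengthScale⁻¹ • x j)]
  have h1 : ∑ j, (1 - c (θ.lengthScale⁻¹ • x i) (θ.lengthScale⁻¹ • x j)) ≤ m * η :=
    (Finset.sum_le_sum fun j _ => by linarith [hx i j]).trans_eq
      (by simp : ∑ _j : Fin m, η = m * η)
  refine ⟨by positivity, ?_⟩
  rw [div_le_iff₀ (by positivity)]
  nlinarith

include hxs

/-- The uniform vector `1/m` nearly solves the system that defines the weights: its residual is of
order `η` in each entry. Coercivity of `K` turns this into a bound on the distance of the weights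
from `1/m`. -/
lemma gpWeights_dotProduct_self_le :
    m * (gpWeights c θ x xs ⬝ᵥ gpWeights c θ x xs) ≤
      2 + 2 * ((θ.noiseVar + θ.kernelScale) / θ.noiseVar) ^ 2 * (m * η) ^ 2 := by
  have ha := θ.kernelScale_pos
  have hl := θ.noiseVar_pos
  have hm1 : (1 : ℝ) ≤ m := by exact_mod_cast hm
  set K := shiftedGram c θ x
  have hK : IsUnit K.det := (shiftedGram_posDef hc θ x).isUnit.map Matrix.detMonoidHom
  set w : Fin m → ℝ := gpWeights c θ x xs
  set S := θ.noiseVar + m * θ.kernelScale with hS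
  have hSpos : 0 < S := by positivity
  set e : Fin m → ℝ := w - fun _ => (m : ℝ)⁻¹ with he
  have hKw : K *ᵥ w = gammaFactor θ m • crossCov c θ x xs := by
    simp only [w, gpWeights]
    rw [Matrix.mulVec_smul, Matrix.mulVec_mulVec, Matrix.mul_nonsing_inv _ hK, Matrix.one_mulVec]
  have hG : gammaFactor θ m * θ.kernelScale = S / m := by
    rw [gammaFactor, hS]; field_simp
  have hr : ∀ i, |(K *ᵥ e) i| ≤ (θ.noiseVar + θ.kernelScale) * η := by
    intro i
    obtain ⟨h1, h2⟩ := meanDefect_nonneg_and_le hc θ hm hx i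
    have h3 := hc.le_one (θ.lengthScale⁻¹ • xs) (θ.lengthScale⁻¹ • x i)
    have h4 := hxs i
    rw [he, Matrix.mulVec_sub, hKw, Pi.sub_apply, shiftedGram_mulVec_const c θ x]
    simp only [Pi.smul_apply, crossCov, smul_eq_mul]
    rw [← mul_assoc, hG]
    set D := ∑ j, (1 - c (θ.lengthScale⁻¹ • x i) (θ.lengthScale⁻¹ • x j))
    -- The correlation defect lies in `[-η, 0]` and the row defect in `[0, η]`; having opposite
    -- signs, they add up to at most `η` in absolute value.
    have : S / m * c (θ.lengthScale⁻¹ • xs) (θ.lengthScale⁻¹ • x i) -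
        (m : ℝ)⁻¹ * (S - θ.kernelScale * D) =
        S / m * (c (θ.lengthScale⁻¹ • xs) (θ.lengthScale⁻¹ • x i) - 1 + θ.kernelScale * D / S) := by
      field_simp; ring
    rw [this, abs_mul, abs_of_pos (by positivity : 0 < S / m)]
    have hη : 0 ≤ η := h1.trans h2
    have hSm : S / m ≤ θ.noiseVar + θ.kernelScale := by
      rw [div_le_iff₀ (by positivity), hS]; nlinarith
    refine mul_le_mul hSm ?_ (abs_nonneg _) (by positivity)
    rw [abs_le]; constructor <;> linarith
  have hee := dotProduct_self_le_of_shiftedGram_mulVec_eq hc θ x rfl hr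
  have hw : w ⬝ᵥ w ≤ 2 * (m : ℝ)⁻¹ + 2 * (e ⬝ᵥ e) := by
    have : ∀ i, w i * w i ≤ 2 * ((m : ℝ)⁻¹ * (m : ℝ)⁻¹) + 2 * (e i * e i) := by
      intro i
      have : w i = (m : ℝ)⁻¹ + e i := by simp [he]
      rw [this]; nlinarith [sq_nonneg ((m : ℝ)⁻¹ - e i)]
    calc w ⬝ᵥ w ≤ ∑ i, (2 * ((m : ℝ)⁻¹ * (m : ℝ)⁻¹) + 2 * (e i * e i)) :=
          Finset.sum_le_sum fun i _ => this i
      _ = 2 * (m : ℝ)⁻¹ + 2 * (e ⬝ᵥ e) := by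
          simp only [Finset.sum_add_distrib, ← Finset.mul_sum, dotProduct]
          simp
          field_simp
  have hee' : e ⬝ᵥ e ≤ m * (((θ.noiseVar + θ.kernelScale) / θ.noiseVar) ^ 2 * η ^ 2) := by
    rw [div_pow, div_mul_eq_mul_div, mul_div_assoc', le_div_iff₀ (by positivity)]
    linarith
  calc m * (w ⬝ᵥ w) ≤ m * (2 * (m : ℝ)⁻¹ +
        2 * (m * (((θ.noiseVar + θ.kernelScale) / θ.noiseVar) ^ 2 * η ^ 2))) := by gcongr; linarith
    _ = _ := by field_simp

/-- Bounding `∑ w - 1` through the distance of `w` from `1/m` would only give order `m η`, which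
need not be small. The constant vector 1 is instead written as `K (1/S) + s` with entries of `s` at
most `η`. By symmetry of `K`, pairing with `w` gives the mean correlation with the test point plus
`s ⬝ᵥ w`. -/
lemma gpWeights_sum_sub_one_sq_le :
    (∑ j, gpWeights c θ x xs j - 1) ^ 2 ≤
      2 * η ^ 2 * (1 + m * (gpWeights c θ x xs ⬝ᵥ gpWeights c θ x xs)) := by
  have ha := θ.kernelScale_pos
  have hl := θ.noiseVar_pos
  have hm1 : (1 : ℝ) ≤ m := by exact_mod_cast hm
  set K := shiftedGram c θ x with hKdef
  have hK : IsUnit K.det := (shiftedGram_posDef hc θ x).isUnit.map Matrix.detMonoidHom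
  set w : Fin m → ℝ := gpWeights c θ x xs
  set S := θ.noiseVar + m * θ.kernelScale with hS
  have hSpos : 0 < S := by positivity
  have hKw : K *ᵥ w = gammaFactor θ m • crossCov c θ x xs := by
    simp only [w, gpWeights]
    rw [Matrix.mulVec_smul, Matrix.mulVec_mulVec, Matrix.mul_nonsing_inv _ hK, Matrix.one_mulVec]
  have hG : gammaFactor θ m * θ.kernelScale = S / m := by
    rw [gammaFactor, hS]; field_simp
  set s : Fin m → ℝ := fun i => θ.kernelScale *
    (∑ j, (1 - c (θ.lengthScale⁻¹ • x i) (θ.lengthScale⁻¹ • x j))) / S with hs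
  have hs' : ∀ i, |s i| ≤ η := fun i => by
    obtain ⟨h1, h2⟩ := meanDefect_nonneg_and_le hc θ hm hx i
    rw [abs_of_nonneg h1]; exact h2
  have hone : (fun _ => (1 : ℝ)) = (K *ᵥ fun _ => S⁻¹) + s := by
    funext i
    rw [Pi.add_apply, shiftedGram_mulVec_const c θ x, ← hS]
    simp only [hs]
    field_simp; ring
  have hsum : ∑ j, w j = (∑ j, c (θ.lengthScale⁻¹ • xs) (θ.lengthScale⁻¹ • x j)) / m + s ⬝ᵥ w := by
    have h1 : ∑ j, w j = (fun _ => (1 : ℝ)) ⬝ᵥ w := by simp [dotProduct]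
    rw [h1, hone, add_dotProduct, dotProduct_comm (K *ᵥ _), Matrix.dotProduct_mulVec,
      ← Matrix.mulVec_transpose, hKdef, shiftedGram_transpose hc, ← hKdef, hKw]
    congr 1
    simp only [dotProduct, Pi.smul_apply, crossCov, smul_eq_mul, ← mul_assoc, hG]
    rw [← Finset.sum_mul, ← Finset.mul_sum]
    field_simp
  have hmean : |(∑ j, c (θ.lengthScale⁻¹ • xs) (θ.lengthScale⁻¹ • x j)) / m - 1| ≤ η := by
    have h1 : ∑ j, c (θ.lengthScale⁻¹ • xs) (θ.lengthScale⁻¹ • x j) ≤ m :=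
      (Finset.sum_le_sum fun j _ => hc.le_one _ _).trans_eq
        (by simp : ∑ _j : Fin m, (1 : ℝ) = m)
    have h2 : m * (1 - η) ≤ ∑ j, c (θ.lengthScale⁻¹ • xs) (θ.lengthScale⁻¹ • x j) :=
      (by simp; ring : m * (1 - η) = ∑ _j : Fin m, (1 - η)).trans_le
        (Finset.sum_le_sum fun j _ => hxs j)
    have hη : 0 ≤ η := (abs_nonneg _).trans (hs' ⟨0, hm⟩)
    have h3 : (∑ j, c (θ.lengthScale⁻¹ • xs) (θ.lengthScale⁻¹ • x j)) / m ≤ 1 := by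
      rw [div_le_iff₀ (by positivity)]; linarith
    have h4 : 1 - η ≤ (∑ j, c (θ.lengthScale⁻¹ • xs) (θ.lengthScale⁻¹ • x j)) / m := by
      rw [le_div_iff₀ (by positivity)]; linarith
    rw [abs_le]; constructor <;> linarith
  have hcs := sq_sum_le_of_abs_le (z := w) hs'
  rw [hsum]
  set M := (∑ j, c (θ.lengthScale⁻¹ • xs) (θ.lengthScale⁻¹ • x j)) / m
  have hM : (M - 1) ^ 2 ≤ η ^ 2 := by
    rw [← sq_abs]; exact pow_le_pow_left₀ (abs_nonneg _) hmean 2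
  nlinarith [sq_nonneg (M - 1 - s ⬝ᵥ w)]

end WeightBounds

/-! ### Distances of the nearest neighbours. -/

lemma kernelMetric_lt_of_dist_lt {d : ℕ} {c : Cov d → Cov d → ℝ}
    (hc : IsNormalizedKernel c) (hiso : IsStrictlyDecreasingIsotropic c) {ℓ : ℝ} (hℓ : 0 < ℓ)
    {x y z : Cov d} (h : dist x y < dist x z) : kernelMetric c ℓ x y < kernelMetric c ℓ x z := by
  obtain ⟨φ, hφ, hcφ⟩ := hiso
  have h1 : dist (ℓ⁻¹ • x) (ℓ⁻¹ • y) < dist (ℓ⁻¹ • x) (ℓ⁻¹ • z) := by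
    rw [dist_smul₀, dist_smul₀]
    have : 0 < ‖ℓ⁻¹‖ := norm_pos_iff.2 (inv_ne_zero hℓ.ne')
    gcongr
  have h2 := hφ (Set.mem_Ici.2 dist_nonneg) (Set.mem_Ici.2 dist_nonneg) h1
  rw [← hcφ, ← hcφ] at h2
  unfold kernelMetric
  exact Real.sqrt_lt_sqrt (by linarith [hc.le_one (ℓ⁻¹ • x) (ℓ⁻¹ • y)]) (by linarith)

/-- The number of sample points within distance `r` of `x`. -/
noncomputable def countWithin {d n : ℕ} (x : Cov d) (r : ℝ) (X : Fin n → Cov d) : ℕ :=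
  (Finset.univ.filter fun i => dist x (X i) ≤ r).card

/-- If the neighbour at position `j < m` were farther than `r`, at least `m` points would have
strictly smaller kernel distance, whereas at most `j` entries of a sorted list lie strictly below
the one at position `j`. Strict comparison makes the treatment of ties irrelevant. -/
lemma dist_nnIndex_le {d n m : ℕ} {c : Cov d → Cov d → ℝ}
    (hc : IsNormalizedKernel c) (hiso : IsStrictlyDecreasingIsotropic c) (θ : Hyperparameters)
    (hm : m ≤ n) {X : Fin n → Cov d} {xs : Cov d} {r : ℝ} (hr : m ≤ countWithin xs r X)
    (j : Fin m) : dist xs (X (nnIndex c θ hm X xs j)) ≤ r := by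
  classical
  by_contra! hlt
  set f : Fin n → ℝ := fun i => kernelMetric c θ.lengthScale xs (X i) with hf
  set σ := Tuple.sort f with hσ
  set k : Fin n := Fin.castLE hm j with hk
  have hidx : nnIndex c θ hm X xs j = σ k := rfl
  rw [hidx] at hlt
  have h1 := (Tuple.lt_card_lt_iff_apply_lt_of_monotone (j := k) (a := f (σ k))
    (Tuple.monotone_sort f)).not.2 (lt_irrefl _)
  have h2 : countWithin xs r X ≤ (Finset.univ.filter fun i => (f ∘ σ) i < f (σ k)).card := by
    refine Finset.card_le_card_of_injOn σ.symm (fun i hi => ?_) σ.symm.injective.injOn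
    simp only [Finset.coe_filter, Finset.mem_univ, true_and, Set.mem_ofPred_eq] at hi ⊢
    simp only [Function.comp_apply, Equiv.apply_symm_apply]
    exact kernelMetric_lt_of_dist_lt hc hiso θ.lengthScale_pos (hi.trans_lt hlt)
  have h3 : (k : ℕ) < m := j.2
  have h4 : (Finset.univ.filter fun i => (f ∘ σ) i < f (σ k)).card ≤ k := by
    simpa using h1
  omega

lemma nnIndex_injective {d n m : ℕ} (c : Cov d → Cov d → ℝ) (θ : Hyperparameters)
    (hm : m ≤ n) (X : Fin n → Cov d) (xs : Cov d) :
    Function.Injective (nnIndex c θ hm X xs) :=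
  (Equiv.injective _).comp (Fin.castLE_injective hm)

/-! ### Measurability of the neighbour selection and of the weights. -/

/-- The sorting permutation, with ties broken by index, is characterised by finitely many
comparisons of coordinates. -/
lemma measurableSet_sort_eq {n : ℕ} (σ : Equiv.Perm (Fin n)) :
    MeasurableSet {f : Fin n → ℝ | Tuple.sort f = σ} := by
  have : {f : Fin n → ℝ | Tuple.sort f = σ} =
      {f | (∀ i j, i ≤ j → f (σ i) ≤ f (σ j)) ∧
        ∀ i j, i < j → f (σ i) = f (σ j) → σ i < σ j} := by
    ext f
    rw [Set.mem_ofPred_eq, eq_comm, Tuple.eq_sort_iff]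
    rfl
  rw [this]
  simp only [Set.ofPred_and, Set.ofPred_forall]
  refine MeasurableSet.inter ?_ ?_
  · exact MeasurableSet.iInter fun i => MeasurableSet.iInter fun j => MeasurableSet.iInter fun _ =>
      measurableSet_le (measurable_pi_apply (σ i)) (measurable_pi_apply (σ j))
  · refine MeasurableSet.iInter fun i => MeasurableSet.iInter fun j => MeasurableSet.iInter fun _ => ?_
    by_cases h : σ i < σ j
    · simp [h]
    · simp only [h, imp_false]
      exact (measurableSet_eq_fun (measurable_pi_apply (σ i)) (measurable_pi_apply (σ j))).compl

/-- A quantity that depends on the sorting permutation of measurable data is measurable if it is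
measurable for each fixed permutation. -/
lemma measurable_sort_comp {Ω β : Type*} [MeasurableSpace Ω] [MeasurableSpace β] {n : ℕ}
    {f : Ω → Fin n → ℝ} (hf : Measurable f) {F : Equiv.Perm (Fin n) → Ω → β}
    (hF : ∀ σ, Measurable (F σ)) : Measurable fun u => F (Tuple.sort (f u)) u := by
  intro s hs
  have : (fun u => F (Tuple.sort (f u)) u) ⁻¹' s =
      ⋃ σ : Equiv.Perm (Fin n), (f ⁻¹' {g | Tuple.sort g = σ}) ∩ (F σ ⁻¹' s) := by
    ext u
    simp
  rw [this]
  exact MeasurableSet.iUnion fun σ => (hf (measurableSet_sort_eq σ)).inter (hF σ hs)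

lemma continuous_kernel_smul {d : ℕ} {c : Cov d → Cov d → ℝ} (hc : IsNormalizedKernel c) (t : ℝ)
    {T : Type*} [TopologicalSpace T] {f g : T → Cov d} (hf : Continuous f) (hg : Continuous g) :
    Continuous fun s => c (t • f s) (t • g s) :=
  hc.continuous.comp ((hf.const_smul t).prodMk (hg.const_smul t))

lemma continuous_gpWeights {d m : ℕ} {c : Cov d → Cov d → ℝ} (hc : IsNormalizedKernel c)
    (θ : Hyperparameters) :
    Continuous fun s : (Fin m → Cov d) × Cov d => gpWeights c θ s.1 s.2 := by
  have hK : Continuous fun s : (Fin m → Cov d) × Cov d => shiftedGram c θ s.1 := by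
    refine continuous_matrix fun i j => ?_
    simp only [shiftedGram, Matrix.of_apply]
    exact ((continuous_kernel_smul hc _ ((continuous_apply i).comp continuous_fst)
      ((continuous_apply j).comp continuous_fst)).const_mul _).add continuous_const
  have hk : Continuous fun s : (Fin m → Cov d) × Cov d => crossCov c θ s.1 s.2 := by
    refine continuous_pi fun j => ?_
    simp only [crossCov]
    exact (continuous_kernel_smul hc _ continuous_snd
      ((continuous_apply j).comp continuous_fst)).const_mul _
  have hKi : Continuous fun s : (Fin m → Cov d) × Cov d => (shiftedGram c θ s.1)⁻¹ := by
    simp only [Matrix.inv_def, Ring.inverse_eq_inv']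
    exact (hK.matrix_det.inv₀ fun s => (shiftedGram_posDef hc θ s.1).det_pos.ne').smul
      hK.matrix_adjugate
  exact (hKi.matrix_mulVec hk).const_smul (gammaFactor θ m)

/-- The weights of the nearest neighbours. -/
noncomputable def nnWeights {d n m : ℕ} (c : Cov d → Cov d → ℝ) (θ : Hyperparameters)
    (hm : m ≤ n) (X : Fin n → Cov d) (xs : Cov d) : Fin m → ℝ :=
  gpWeights c θ (fun j => X (nnIndex c θ hm X xs j)) xs

lemma gpnnPredictor_eq_sum {d n m : ℕ} {c : Cov d → Cov d → ℝ} (hc : IsNormalizedKernel c)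
    (θ : Hyperparameters) (hm : m ≤ n) (X : Fin n → Cov d) (Y : Fin n → ℝ) (xs : Cov d) :
    gpnnPredictor c θ hm X Y xs =
      ∑ j, nnWeights c θ hm X xs j * Y (nnIndex c θ hm X xs j) :=
  correctedMean_eq_dotProduct hc _ _ _ _

section Measurability

variable {d n m : ℕ} {c : Cov d → Cov d → ℝ}

lemma measurable_kernelMetric_sample (hc : IsNormalizedKernel c) (ℓ : ℝ) :
    Measurable fun s : (Fin n → Cov d) × Cov d => fun i => kernelMetric c ℓ s.2 (s.1 i) := by
  refine measurable_pi_lambda _ fun i => Continuous.measurable ?_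
  simp only [kernelMetric]
  exact (continuous_const.sub (continuous_kernel_smul hc _ continuous_snd
      ((continuous_apply i).comp continuous_fst))).sqrt

lemma measurable_nnWeights (hc : IsNormalizedKernel c) (θ : Hyperparameters) (hm : m ≤ n)
    (j : Fin m) :
    Measurable fun s : (Fin n → Cov d) × Cov d => nnWeights c θ hm s.1 s.2 j := by
  refine measurable_sort_comp (measurable_kernelMetric_sample hc θ.lengthScale)
    (F := fun σ s => gpWeights c θ (fun j => s.1 (σ (Fin.castLE hm j))) s.2 j) fun σ => ?_
  have h : Continuous fun s : (Fin n → Cov d) × Cov d =>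
      ((fun j => s.1 (σ (Fin.castLE hm j)), s.2) : (Fin m → Cov d) × Cov d) := by fun_prop
  exact ((continuous_apply j).comp ((continuous_gpWeights hc θ).comp h)).measurable

/-- A measurable function of sample and test point, indexed by the sample points, remains
measurable when evaluated at the `j`-th nearest neighbour. -/
lemma measurable_nnIndex_comp {Ω β : Type*} [MeasurableSpace Ω] [MeasurableSpace β]
    (hc : IsNormalizedKernel c) (θ : Hyperparameters) (hm : m ≤ n) {X : Ω → Fin n → Cov d}
    {x : Ω → Cov d} (hX : Measurable X) (hx : Measurable x) {F : Fin n → Ω → β}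
    (hF : ∀ i, Measurable (F i)) (j : Fin m) :
    Measurable fun u => F (nnIndex c θ hm (X u) (x u) j) u :=
  measurable_sort_comp ((measurable_kernelMetric_sample hc θ.lengthScale).comp (hX.prodMk hx))
    (F := fun σ u => F (σ (Fin.castLE hm j)) u) fun _ => hF _

lemma measurable_countWithin (r : ℝ) :
    Measurable fun s : (Fin n → Cov d) × Cov d => countWithin s.2 r s.1 := by
  classical
  simp only [countWithin, Finset.card_filter]
  refine Finset.measurable_sum _ fun i _ => Measurable.ite ?_ measurable_const measurable_const
  exact measurableSet_le (measurable_snd.dist ((measurable_pi_apply i).comp measurable_fst))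
    measurable_const

end Measurability

/-! ### Variance of the weighted noise. -/

/-- Injectivity of `idx` makes the selected noises distinct coordinates, hence pairwise independent,
so that variances add. -/
lemma lintegral_sq_sum_noise_le {n m : ℕ} {Pξ : Measure ℝ} {σ : ℝ} (hξ : IsNoiseLaw Pξ σ)
    {idx : Fin m → Fin n} (hidx : Function.Injective idx) (v : Fin m → ℝ) :
    ∫⁻ Ξ : Fin n → ℝ, ENNReal.ofReal ((∑ j, v j * Ξ (idx j)) ^ 2) ∂(Measure.pi fun _ => Pξ) ≤
      ENNReal.ofReal (σ ^ 2 * (v ⬝ᵥ v)) := by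
  have := hξ.isProbabilityMeasure
  set μ : Measure (Fin n → ℝ) := Measure.pi fun _ => Pξ
  have hmp : ∀ i, MeasurePreserving (fun Ξ : Fin n → ℝ => Ξ i) μ Pξ := fun i =>
    measurePreserving_eval _ i
  set W : Fin m → (Fin n → ℝ) → ℝ := fun j Ξ => v j * Ξ (idx j) with hW
  have hL2 : ∀ i : Fin n, MemLp (fun Ξ : Fin n → ℝ => Ξ i) 2 μ := fun i =>
    hξ.memLp.comp_measurePreserving (hmp i)
  have hWL : ∀ j, MemLp (W j) 2 μ := fun j => (hL2 (idx j)).const_mul (v j)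
  have hind : iIndepFun (fun (i : Fin n) (Ξ : Fin n → ℝ) => Ξ i) μ :=
    iIndepFun_pi (X := fun _ => id) fun _ => aemeasurable_id
  have hvar : Var[∑ j, W j; μ] = ∑ j, Var[W j; μ] := by
    refine IndepFun.variance_sum (fun j _ => hWL j) fun i _ j _ hij => ?_
    exact (hind.indepFun (hidx.ne hij)).comp (measurable_const_mul (v i))
      (measurable_const_mul (v j))
  have hWvar : ∀ j, Var[W j; μ] = v j ^ 2 * σ ^ 2 := by
    intro j
    rw [hW, variance_const_mul, ← hξ.variance_eq]
    congr 1
    exact (hmp (idx j)).variance_fun_comp (f := id) hξ.memLp.aestronglyMeasurable.aemeasurable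
  have hWmean : ∀ j, ∫ Ξ, W j Ξ ∂μ = 0 := by
    intro j
    rw [hW, integral_const_mul]
    have h : ∫ Ξ, Ξ (idx j) ∂μ = ∫ s, s ∂Pξ := by
      rw [← (hmp (idx j)).map_eq]
      exact (integral_map (hmp (idx j)).aemeasurable aestronglyMeasurable_id).symm
    rw [h, hξ.mean_zero, mul_zero]
  have hsumL : MemLp (∑ j, W j) 2 μ := memLp_finsetSum' _ fun j _ => hWL j
  have hmean : ∫ Ξ, (∑ j, W j) Ξ ∂μ = 0 := by
    simp only [Finset.sum_apply]
    rw [integral_finsetSum _ fun j _ => (hWL j).integrable one_le_two]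
    simp [hWmean]
  rw [variance_of_integral_eq_zero hsumL.aestronglyMeasurable.aemeasurable hmean] at hvar
  have : ∀ Ξ, (∑ j, v j * Ξ (idx j)) ^ 2 = (∑ j, W j) Ξ ^ 2 := by intro Ξ; simp [hW]
  simp only [this]
  rw [← ofReal_integral_eq_lintegral_ofReal hsumL.integrable_sq (ae_of_all _ fun Ξ => by
    exact sq_nonneg _), hvar]
  apply ENNReal.ofReal_le_ofReal
  simp only [hWvar, dotProduct, Finset.mul_sum]
  exact Finset.sum_le_sum fun j _ => by nlinarith

/-! ### Ball masses, sample counts and the spread of the neighbours. -/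

/-- A density bounded below on a compact convex set gives balls a mass of order `r ^ d`. -/
lemma HasSmoothPosDensityOnCompactConvex.exists_ball_mass {d : ℕ} {P : Measure (Cov d)}
    [IsProbabilityMeasure P] (hP : HasSmoothPosDensityOnCompactConvex P) :
    ∃ C : Set (Cov d), P Cᶜ = 0 ∧ ∃ R : ℝ, 1 ≤ R ∧ (∀ x ∈ C, ∀ y ∈ C, dist x y ≤ R) ∧
      ∃ κ : ℝ, 0 < κ ∧ ∀ x ∈ C, ∀ r, 0 ≤ r → r ≤ R →
        κ * r ^ d ≤ P.real (Metric.closedBall x r) := by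
  obtain ⟨C, ρ, hC, hconv, hρ, hpos, hPeq⟩ := hP
  have hCm : MeasurableSet C := hC.isClosed.measurableSet
  have hCc : P Cᶜ = 0 := by
    rw [hPeq]
    exact withDensity_absolutelyContinuous _ _ (by
      rw [Measure.restrict_apply hCm.compl]; simp)
  have hvol : volume C ≠ 0 := by
    intro h0
    have h1 : P Set.univ = 0 := by
      rw [hPeq]
      exact withDensity_absolutelyContinuous _ _ (by simpa using h0)
    simp at h1
  have hne : C.Nonempty := by
    by_contra h
    rw [Set.not_nonempty_iff_eq_empty] at h
    simp [h] at hvol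
  obtain ⟨x₀, hx₀, hmin⟩ := hC.exists_isMinOn hne hρ.continuousOn
  have hvf : volume C ≠ ⊤ := hC.measure_lt_top.ne
  -- The maximum with 1 permits division by `R`; `1 ≤ R` is also needed later, when Hölder exponents
  -- are lowered.
  set R := max (Metric.diam C) 1 with hR
  have hR1 : 1 ≤ R := le_max_right _ _
  have hdist : ∀ x ∈ C, ∀ y ∈ C, dist x y ≤ R := fun x hx y hy =>
    (Metric.dist_le_diam_of_mem hC.isBounded hx hy).trans (le_max_left _ _)
  refine ⟨C, hCc, R, hR1, hdist, ρ x₀ * volume.real C / R ^ d, ?_, ?_⟩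
  · have : 0 < volume.real C := ENNReal.toReal_pos hvol hvf
    have := hpos x₀ hx₀
    positivity
  · intro x hx r hr hrR
    set t := r / R with ht
    have ht0 : 0 ≤ t := by positivity
    have ht1 : t ≤ 1 := (div_le_one (by positivity)).2 hrR
    -- The copy of `C` contracted towards `x` by the factor `r / R` stays in `C` by convexity, lies
    -- in the ball, and has volume `(r / R) ^ d` times that of `C`. This works at boundary points as
    -- well.
    set S := AffineMap.homothety x t '' C with hS
    have hSC : S ⊆ C := by
      rintro _ ⟨y, hy, rfl⟩
      rw [AffineMap.homothety_eq_lineMap]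
      exact hconv.lineMap_mem hx hy ⟨ht0, ht1⟩
    have hSb : S ⊆ Metric.closedBall x r := by
      rintro _ ⟨y, hy, rfl⟩
      rw [Metric.mem_closedBall, dist_homothety_center, Real.norm_of_nonneg ht0, ht,
        div_mul_eq_mul_div, div_le_iff₀ (by positivity)]
      exact mul_le_mul_of_nonneg_left (hdist x hx y hy) hr
    have hSm : MeasurableSet S := by
      refine (hC.image ?_).isClosed.measurableSet
      exact AffineMap.homothety_continuous x t
    have hSvol : volume S = ENNReal.ofReal (t ^ d) * volume C := by
      rw [hS, Measure.addHaar_image_homothety, finrank_euclideanSpace_fin, abs_of_nonneg (by positivity)]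
    have h1 : ENNReal.ofReal (ρ x₀) * volume S ≤ P S := by
      rw [hPeq, withDensity_apply _ hSm, Measure.restrict_restrict hSm,
        Set.inter_eq_left.2 hSC, ← setLIntegral_const]
      exact setLIntegral_mono' hSm fun y hy => ENNReal.ofReal_le_ofReal (hmin (hSC hy))
    have h2 : ENNReal.ofReal (ρ x₀) * volume S ≤ P (Metric.closedBall x r) :=
      h1.trans (measure_mono hSb)
    rw [hSvol] at h2
    have h3 := ENNReal.toReal_mono (measure_ne_top _ _) h2
    rw [ENNReal.toReal_mul, ENNReal.toReal_mul, ENNReal.toReal_ofReal (hpos x₀ hx₀).le,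
      ENNReal.toReal_ofReal (by positivity)] at h3
    refine le_trans (le_of_eq ?_) h3
    rw [ht, div_pow, Measure.real]
    ring

/-- A Chernoff bound for the event that a ball contains fewer than `m` sample points. -/
lemma measure_countWithin_lt_le {d n m : ℕ} (P : Measure (Cov d)) [IsProbabilityMeasure P]
    (x : Cov d) (r : ℝ) :
    (Measure.pi fun _ : Fin n => P) {X | countWithin x r X < m} ≤
      ENNReal.ofReal (Real.exp (m - n * P.real (Metric.closedBall x r) / 2)) := by
  classical
  set B := Metric.closedBall x r with hB
  have hBm : MeasurableSet B := Metric.isClosed_closedBall.measurableSet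
  set π := P.real B with hπ
  have hπ0 : 0 ≤ π := measureReal_nonneg
  have hπ1 : π ≤ 1 := measureReal_le_one
  -- The product of `exp (g (X i))` is `exp (-count)`, to which Markov's inequality is applied at
  -- level `exp (-m)`.
  set g : Cov d → ℝ := B.indicator fun _ => -1 with hg
  have hgm : Measurable g := measurable_const.indicator hBm
  have hint : Integrable (fun y => Real.exp (g y)) P := by
    refine Integrable.of_bound (C := 1) hgm.exp.aestronglyMeasurable (ae_of_all _ fun y => ?_)
    rw [Real.norm_of_nonneg (Real.exp_nonneg _)]
    simp only [hg, Set.indicator]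
    split_ifs <;> simp
  -- The integral is `1 - π (1 - e⁻¹)`, which is at most `1 - π / 2` because `e ≥ 2`.
  have hexp : ∫ y, Real.exp (g y) ∂P ≤ Real.exp (-(π / 2)) := by
    have h1 : ∀ y, Real.exp (g y) = 1 + B.indicator (fun _ => Real.exp (-1) - 1) y := by
      intro y
      simp only [hg, Set.indicator]
      split_ifs <;> simp
    simp only [h1]
    rw [integral_add (integrable_const _) ((integrable_const _).indicator hBm),
      integral_indicator hBm]
    simp only [integral_const, probReal_univ, smul_eq_mul, measureReal_restrict_apply_univ]
    have h2 : Real.exp (-1) ≤ 1 / 2 := by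
      rw [Real.exp_neg, one_div]
      exact inv_anti₀ (by norm_num) (by linarith [Real.add_one_le_exp (1 : ℝ)])
    have h3 := Real.add_one_le_exp (-(π / 2))
    nlinarith
  have hcount : ∀ X : Fin n → Cov d, ∑ i, g (X i) = -(countWithin x r X : ℝ) := by
    intro X
    simp only [countWithin, Finset.card_filter, hg, Set.indicator, hB, Metric.mem_closedBall,
      dist_comm]
    push_cast
    rw [← Finset.sum_neg_distrib]
    exact Finset.sum_congr rfl fun i _ => by split_ifs <;> simp
  set μ := Measure.pi fun _ : Fin n => P
  have hintpi : Integrable (fun X : Fin n → Cov d => ∏ i, Real.exp (g (X i))) μ :=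
    Integrable.fintype_prod fun _ => hint
  have hmark := mul_meas_ge_le_integral_of_nonneg (μ := μ)
    (f := fun X : Fin n → Cov d => ∏ i, Real.exp (g (X i)))
    (ae_of_all _ fun X => Finset.prod_nonneg fun i _ => Real.exp_nonneg _) hintpi (Real.exp (-m))
  rw [integral_fintype_prod_eq_pow (μ := P) (ι := Fin n) (fun y => Real.exp (g y)),
    Fintype.card_fin] at hmark
  have hsub : {X : Fin n → Cov d | countWithin x r X < m} ⊆
      {X | Real.exp (-m) ≤ ∏ i, Real.exp (g (X i))} := by
    intro X hX
    simp only [Set.mem_ofPred_eq, ← Real.exp_sum, hcount] at hX ⊢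
    gcongr
  refine (measure_mono hsub).trans ?_
  rw [← ofReal_measureReal]
  apply ENNReal.ofReal_le_ofReal
  have h4 : (∫ y, Real.exp (g y) ∂P) ^ n ≤ Real.exp (-(n * π / 2)) := by
    refine (pow_le_pow_left₀ (integral_nonneg fun y => Real.exp_nonneg _) hexp n).trans_eq ?_
    rw [← Real.exp_nat_mul]; congr 1; ring
  rw [sub_eq_add_neg, Real.exp_add]
  refine le_trans ?_ (mul_le_mul_of_nonneg_left (hmark.trans h4) (Real.exp_nonneg m))
  rw [← mul_assoc, ← Real.exp_add]; simp

/-- A random factor that dominates the eighth power of the `m`-th nearest neighbour distance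
measured in units of `s` and rounded up to a power of two. -/
noncomputable def spreadFactor {d n : ℕ} (m : ℕ) (s : ℝ) (x : Cov d) (X : Fin n → Cov d) : ℝ≥0∞ :=
  1 + ∑' k : ℕ, {Y : Fin n → Cov d | countWithin x (2 ^ k * s) Y < m}.indicator
    (fun _ => ENNReal.ofReal (2 ^ (8 * (k + 1)))) X

/-- Take `u = 2 ^ k` with the least `k` whose ball holds `m` points. For `k = 0` the summand 1
suffices; otherwise the ball one level below fails, and its term in the series is exactly `u ^ 8`.
-/
lemma exists_scale_le_spreadFactor {d n m : ℕ} (hm : m ≤ n) {s : ℝ} (hs : 0 < s) (x : Cov d)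
    (X : Fin n → Cov d) :
    ∃ u : ℝ, 1 ≤ u ∧ m ≤ countWithin x (u * s) X ∧
      ENNReal.ofReal (u ^ 8) ≤ spreadFactor m s x X := by
  classical
  have hex : ∃ k : ℕ, m ≤ countWithin x (2 ^ k * s) X := by
    obtain ⟨D, hD⟩ := (Set.finite_range fun i => dist x (X i)).bddAbove
    obtain ⟨k, hk⟩ := pow_unbounded_of_one_lt (D / s) one_lt_two
    refine ⟨k, hm.trans_eq ?_⟩
    rw [countWithin, Finset.filter_true_of_mem, Finset.card_fin]
    intro i _
    rw [div_lt_iff₀ hs] at hk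
    exact (hD ⟨i, rfl⟩).trans hk.le
  refine ⟨2 ^ Nat.find hex, one_le_pow₀ one_le_two, Nat.find_spec hex, ?_⟩
  unfold spreadFactor
  rcases hk : Nat.find hex with _ | k
  · simp
  · have hlt : countWithin x (2 ^ k * s) X < m := not_le.1 (Nat.find_min hex (by omega))
    refine le_trans ?_ le_add_self
    refine le_trans ?_ (ENNReal.le_tsum k)
    rw [Set.indicator_of_mem (by exact hlt), ← pow_mul, mul_comm 8]

lemma measurableSet_countWithin_lt {d n : ℕ} (m : ℕ) (x : Cov d) (r : ℝ) :
    MeasurableSet {Y : Fin n → Cov d | countWithin x r Y < m} :=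
  measurable_prodMk_right (y := x)
    (measurableSet_lt (measurable_countWithin r) (measurable_const (a := m)))

/-- At each scale either the ball contains almost every sample, so that `m ≤ n` makes a shortage
null, or the Chernoff exponent is at most `-2 ^ k`. -/
lemma lintegral_spreadFactor_le {d n m : ℕ} (P : Measure (Cov d)) [IsProbabilityMeasure P]
    (hm : m ≤ n) {s : ℝ} (x : Cov d)
    (hs : ∀ k : ℕ, (∀ᵐ y ∂P, dist x y ≤ 2 ^ k * s) ∨
      m - n * P.real (Metric.closedBall x (2 ^ k * s)) / 2 ≤ -(2 : ℝ) ^ k) :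
    ∫⁻ X, spreadFactor m s x X ∂(Measure.pi fun _ : Fin n => P) ≤
      ENNReal.ofReal (1 + 2 ^ 9 * Nat.factorial 9) := by
  set μ := Measure.pi fun _ : Fin n => P
  have hprob : ∀ k : ℕ, μ {Y : Fin n → Cov d | countWithin x (2 ^ k * s) Y < m} ≤
      ENNReal.ofReal (Real.exp (-(2 : ℝ) ^ k)) := by
    intro k
    rcases hs k with h | h
    · have h1 : ∀ᵐ Y ∂μ, ∀ i, dist x (Y i) ≤ 2 ^ k * s :=
        ae_all_iff.2 fun i =>
          (measurePreserving_eval (fun _ : Fin n => P) i).quasiMeasurePreserving.ae h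
      have h2 : μ {Y : Fin n → Cov d | countWithin x (2 ^ k * s) Y < m} = 0 := by
        rw [← compl_mem_ae_iff]
        filter_upwards [h1] with Y hY
        simp only [Set.mem_compl_iff, Set.mem_ofPred_eq, not_lt, countWithin]
        rw [Finset.filter_true_of_mem fun i _ => hY i, Finset.card_fin]
        exact hm
      rw [h2]; exact zero_le
    · exact (measure_countWithin_lt_le P x _).trans
        (ENNReal.ofReal_le_ofReal (Real.exp_le_exp.2 h))
  have hterm : ∀ k : ℕ, ENNReal.ofReal (2 ^ (8 * (k + 1))) *
      μ {Y : Fin n → Cov d | countWithin x (2 ^ k * s) Y < m} ≤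
      ENNReal.ofReal (2 ^ 8 * Nat.factorial 9 * (1 / 2) ^ k) := by
    intro k
    refine (mul_le_mul_right (hprob k) _).trans ?_
    rw [← ENNReal.ofReal_mul (by positivity)]
    apply ENNReal.ofReal_le_ofReal
    -- With `y = 2 ^ k`, `y ^ 9 / 9! ≤ exp y`: eight powers absorb the growth of the terms and the
    -- ninth leaves a geometric series.
    have h1 := Real.pow_div_factorial_le_exp ((2 : ℝ) ^ k) (by positivity) 9
    rw [Real.exp_neg, ← div_eq_mul_inv, div_le_iff₀ (Real.exp_pos _)]
    refine le_trans (le_of_eq ?_) (mul_le_mul_of_nonneg_left h1 (by positivity))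
    have h2 : (2 : ℝ) ^ k * (1 / 2) ^ k = 1 := by rw [← mul_pow]; norm_num
    have h3 : ((Nat.factorial 9 : ℕ) : ℝ) ≠ 0 := by positivity
    rw [pow_mul, pow_succ, show (((2 : ℝ) ^ 8) ^ k) = (2 ^ k) ^ 8 by rw [← pow_mul, ← pow_mul, mul_comm]]
    generalize ((Nat.factorial 9 : ℕ) : ℝ) = F at *
    calc _ = ((2 : ℝ) ^ k * (1 / 2) ^ k) * ((2 ^ k) ^ 8 * 2 ^ 8) := by rw [h2]; ring
      _ = _ := by field_simp
  unfold spreadFactor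
  rw [lintegral_add_left measurable_const, lintegral_tsum fun k =>
    (measurable_const.indicator (measurableSet_countWithin_lt m x _)).aemeasurable]
  simp only [lintegral_indicator (measurableSet_countWithin_lt m x _), lintegral_const,
    Measure.restrict_apply MeasurableSet.univ, Set.univ_inter, measure_univ, mul_one]
  refine (add_le_add le_rfl (ENNReal.tsum_le_tsum hterm)).trans ?_
  rw [← ENNReal.ofReal_tsum_of_nonneg (fun k => by positivity)
    (summable_geometric_two.mul_left _), tsum_mul_left, tsum_geometric_two,
    ← ENNReal.ofReal_one, ← ENNReal.ofReal_add (by positivity) (by positivity)]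
  apply ENNReal.ofReal_le_ofReal
  apply le_of_eq; ring

/-! ### Averaging over field and noise for a fixed design. -/

/-- Moves the test point and the covariates to the outside, so that field and noise are integrated
with neighbours and weights frozen. -/
lemma lintegral_four_reorder {S A B D : Type*} [MeasurableSpace S] [MeasurableSpace A]
    [MeasurableSpace B] [MeasurableSpace D] (μ : Measure S) (ν : Measure A) (τ : Measure B)
    (π : Measure D) [SFinite μ] [SFinite ν] [SFinite τ] [SFinite π] {f : S → A → B → D → ℝ≥0∞}
    (hf : Measurable fun z : S × A × B × D => f z.1 z.2.1 z.2.2.1 z.2.2.2) :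
    ∫⁻ s, ∫⁻ a, ∫⁻ b, ∫⁻ x, f s a b x ∂π ∂τ ∂ν ∂μ =
      ∫⁻ x, ∫⁻ a, ∫⁻ s, ∫⁻ b, f s a b x ∂τ ∂μ ∂ν ∂π := by
  have hg : Measurable fun z : S × A × D => ∫⁻ b, f z.1 z.2.1 b z.2.2 ∂τ := by
    refine Measurable.lintegral_prod_right'
      (f := fun w : (S × A × D) × B => f w.1.1 w.1.2.1 w.2 w.1.2.2) ?_
    exact hf.comp (g := fun z : S × A × B × D => f z.1 z.2.1 z.2.2.1 z.2.2.2)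
      (f := fun w : (S × A × D) × B => (w.1.1, w.1.2.1, w.2, w.1.2.2)) (by fun_prop)
  calc ∫⁻ s, ∫⁻ a, ∫⁻ b, ∫⁻ x, f s a b x ∂π ∂τ ∂ν ∂μ
      = ∫⁻ s, ∫⁻ a, ∫⁻ x, ∫⁻ b, f s a b x ∂τ ∂π ∂ν ∂μ := by
        refine lintegral_congr fun s => lintegral_congr fun a => lintegral_lintegral_swap ?_
        exact (hf.comp (f := fun w : B × D => (s, a, w.1, w.2)) (by fun_prop)).aemeasurable
    _ = ∫⁻ s, ∫⁻ x, ∫⁻ a, ∫⁻ b, f s a b x ∂τ ∂ν ∂π ∂μ := by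
        refine lintegral_congr fun s => lintegral_lintegral_swap ?_
        exact (hg.comp (f := fun w : A × D => (s, w.1, w.2)) (by fun_prop)).aemeasurable
    _ = ∫⁻ x, ∫⁻ s, ∫⁻ a, ∫⁻ b, f s a b x ∂τ ∂ν ∂μ ∂π := by
        refine lintegral_lintegral_swap (Measurable.aemeasurable ?_)
        exact Measurable.lintegral_prod_right'
          (f := fun w : (S × D) × A => ∫⁻ b, f w.1.1 w.2 b w.1.2 ∂τ)
          (hg.comp (f := fun w : (S × D) × A => (w.1.1, w.2, w.1.2)) (by fun_prop))
    _ = _ := by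
        refine lintegral_congr fun x => lintegral_lintegral_swap ?_
        exact (hg.comp (f := fun w : S × A => (w.1, w.2, x)) (by fun_prop)).aemeasurable

lemma risk_eq_lintegral {d n : ℕ} (P : Measure (Cov d)) [IsProbabilityMeasure P] (Pξ : Measure ℝ)
    [IsProbabilityMeasure Pξ] (g : Cov d → ℝ)
    (est : (Fin n → Cov d) → (Fin n → ℝ) → Cov d → ℝ)
    (hest : Measurable fun z : ((Fin n → Cov d) × (Fin n → ℝ)) × Cov d =>
      est z.1.1 (fun i => g (z.1.1 i) + z.1.2 i) z.2 - g z.2) :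
    risk P Pξ g est = ∫⁻ X, ∫⁻ Ξ, ∫⁻ x, ENNReal.ofReal
      ((est X (fun i => g (X i) + Ξ i) x - g x) ^ 2) ∂P ∂(Measure.pi fun _ => Pξ)
        ∂(Measure.pi fun _ => P) := by
  have hmp := measurePreserving_arrowProdEquivProdArrow (Cov d) ℝ (Fin n) (fun _ => P) (fun _ => Pξ)
  have hF : Measurable fun z : (Fin n → Cov d) × (Fin n → ℝ) => ∫⁻ x, ENNReal.ofReal
      ((est z.1 (fun i => g (z.1 i) + z.2 i) x - g x) ^ 2) ∂P :=
    Measurable.lintegral_prod_right' (f := fun z : ((Fin n → Cov d) × (Fin n → ℝ)) × Cov d =>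
      ENNReal.ofReal ((est z.1.1 (fun i => g (z.1.1 i) + z.1.2 i) z.2 - g z.2) ^ 2))
      (hest.pow_const 2).ennreal_ofReal
  refine (hmp.lintegral_comp hF).trans ?_
  rw [lintegral_prod _ hF.aemeasurable]

lemma lintegral_sq_add_three_le {Ω : Type*} [MeasurableSpace Ω] (μ : Measure Ω) {F f₁ f₂ f₃ : Ω → ℝ}
    (h : ∀ s, F s = f₁ s + f₂ s + f₃ s) (h₁ : Measurable f₁) (h₂ : Measurable f₂) :
    ∫⁻ s, ENNReal.ofReal (F s ^ 2) ∂μ ≤ 3 * (∫⁻ s, ENNReal.ofReal (f₁ s ^ 2) ∂μ +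
      ∫⁻ s, ENNReal.ofReal (f₂ s ^ 2) ∂μ + ∫⁻ s, ENNReal.ofReal (f₃ s ^ 2) ∂μ) := by
  rw [← lintegral_add_left (h₁.pow_const 2).ennreal_ofReal, ← lintegral_add_left
    (f := fun s => ENNReal.ofReal (f₁ s ^ 2) + ENNReal.ofReal (f₂ s ^ 2))
    ((h₁.pow_const 2).ennreal_ofReal.add (h₂.pow_const 2).ennreal_ofReal),
    ← lintegral_const_mul' _ _ (by simp)]
  refine lintegral_mono fun s => ?_
  rw [← ENNReal.ofReal_add (sq_nonneg _) (sq_nonneg _), ← ENNReal.ofReal_add (by positivity)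
    (sq_nonneg _), show (3 : ℝ≥0∞) = ENNReal.ofReal 3 by simp, ← ENNReal.ofReal_mul (by norm_num)]
  apply ENNReal.ofReal_le_ofReal
  rw [h]
  nlinarith [sq_nonneg (f₁ s - f₂ s), sq_nonneg (f₁ s - f₃ s), sq_nonneg (f₂ s - f₃ s)]

/-- The expectation over field and noise of the squared error of a weighted average, for a fixed
design. -/
lemma lintegral_sq_weighted_error_le {d n m : ℕ} {Ω : Type*} [MeasurableSpace Ω] (Pw : Measure Ω)
    [IsProbabilityMeasure Pw] {Pξ : Measure ℝ} {σ : ℝ} (hξ : IsNoiseLaw Pξ σ)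
    {G : Cov d → Ω → ℝ} (hG : ∀ x, Measurable (G x)) {X : Fin n → Cov d} {x : Cov d}
    {idx : Fin m → Fin n} (hidx : Function.Injective idx) (v : Fin m → ℝ) {δ B : ℝ}
    (hδ0 : 0 ≤ δ) (hB0 : 0 ≤ B)
    (hδ : ∀ j, ∫⁻ s, ENNReal.ofReal ((G (X (idx j)) s - G x s) ^ 2) ∂Pw ≤ ENNReal.ofReal δ)
    (hB : ∫⁻ s, ENNReal.ofReal (G x s ^ 2) ∂Pw ≤ ENNReal.ofReal B) :
    ∫⁻ s, ∫⁻ Ξ : Fin n → ℝ, ENNReal.ofReal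
        ((∑ j, v j * (G (X (idx j)) s + Ξ (idx j)) - G x s) ^ 2) ∂(Measure.pi fun _ => Pξ) ∂Pw ≤
      ENNReal.ofReal (3 * (m * (v ⬝ᵥ v) * δ + (∑ j, v j - 1) ^ 2 * B + σ ^ 2 * (v ⬝ᵥ v))) := by
  have := hξ.isProbabilityMeasure
  have hvv : 0 ≤ v ⬝ᵥ v := by simpa using dotProduct_star_self_nonneg v
  set μ : Measure (Fin n → ℝ) := Measure.pi fun _ => Pξ
  -- `a` is the local bias and `b` the error from weights not summing to 1; the noise is the third
  -- term. Cauchy–Schwarz handles `a` without any assumption on the dependence between field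
  -- increments.
  set a : Ω → ℝ := fun s => ∑ j, v j * (G (X (idx j)) s - G x s) with ha
  set b : Ω → ℝ := fun s => (∑ j, v j - 1) * G x s with hb
  have ham : Measurable a := by
    refine Finset.measurable_sum _ fun j _ => ?_
    exact ((hG _).sub (hG _)).const_mul _
  have hbm : Measurable b := (hG x).const_mul _
  have hinner : ∀ s, ∫⁻ Ξ : Fin n → ℝ, ENNReal.ofReal
      ((∑ j, v j * (G (X (idx j)) s + Ξ (idx j)) - G x s) ^ 2) ∂μ ≤
      3 * (ENNReal.ofReal (a s ^ 2) + ENNReal.ofReal (b s ^ 2) +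
        ENNReal.ofReal (σ ^ 2 * (v ⬝ᵥ v))) := by
    intro s
    refine (lintegral_sq_add_three_le μ (f₁ := fun _ => a s) (f₂ := fun _ => b s)
      (f₃ := fun Ξ => ∑ j, v j * Ξ (idx j)) (fun Ξ => ?_) measurable_const
      measurable_const).trans ?_
    · simp only [ha, hb, mul_add, mul_sub, Finset.sum_add_distrib, Finset.sum_sub_distrib,
        ← Finset.sum_mul]
      ring
    · simp only [lintegral_const, measure_univ, mul_one]
      gcongr
      exact lintegral_sq_sum_noise_le hξ hidx v
  have hA : ∫⁻ s, ENNReal.ofReal (a s ^ 2) ∂Pw ≤ ENNReal.ofReal (m * (v ⬝ᵥ v) * δ) := by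
    calc ∫⁻ s, ENNReal.ofReal (a s ^ 2) ∂Pw
        ≤ ∫⁻ s, ENNReal.ofReal (v ⬝ᵥ v) *
            ∑ j, ENNReal.ofReal ((G (X (idx j)) s - G x s) ^ 2) ∂Pw := by
          refine lintegral_mono fun s => ?_
          rw [← ENNReal.ofReal_sum_of_nonneg fun j _ => sq_nonneg _, ← ENNReal.ofReal_mul hvv]
          apply ENNReal.ofReal_le_ofReal
          refine (Finset.sum_mul_sq_le_sq_mul_sq Finset.univ v _).trans_eq ?_
          simp [dotProduct, sq]
      _ = ENNReal.ofReal (v ⬝ᵥ v) *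
            ∑ j, ∫⁻ s, ENNReal.ofReal ((G (X (idx j)) s - G x s) ^ 2) ∂Pw := by
          rw [lintegral_const_mul' _ _ ENNReal.ofReal_ne_top, lintegral_finsetSum]
          exact fun j _ => (((hG _).sub (hG _)).pow_const 2).ennreal_ofReal
      _ ≤ ENNReal.ofReal (v ⬝ᵥ v) * ∑ _j : Fin m, ENNReal.ofReal δ := by
          gcongr with j _; exact hδ j
      _ = ENNReal.ofReal (m * (v ⬝ᵥ v) * δ) := by
          rw [← ENNReal.ofReal_sum_of_nonneg fun j _ => hδ0, ← ENNReal.ofReal_mul hvv]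
          congr 1; simp; ring
  have hBb : ∫⁻ s, ENNReal.ofReal (b s ^ 2) ∂Pw ≤ ENNReal.ofReal ((∑ j, v j - 1) ^ 2 * B) := by
    simp only [hb, mul_pow]
    simp_rw [ENNReal.ofReal_mul (sq_nonneg (∑ j, v j - 1))]
    rw [lintegral_const_mul' _ _ ENNReal.ofReal_ne_top]
    gcongr
  refine (lintegral_mono hinner).trans ?_
  rw [lintegral_const_mul' _ _ (by simp), lintegral_add_left
    (f := fun s => ENNReal.ofReal (a s ^ 2) + ENNReal.ofReal (b s ^ 2)) ((ham.pow_const 2).ennreal_ofReal.add (hbm.pow_const 2).ennreal_ofReal),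
    lintegral_add_left (ham.pow_const 2).ennreal_ofReal, lintegral_const, measure_univ, mul_one,
    ENNReal.ofReal_mul (p := 3) (by norm_num), ENNReal.ofReal_add (by positivity) (by positivity),
    ENNReal.ofReal_add (by positivity) (by positivity)]
  simp only [ENNReal.ofReal_ofNat]
  gcongr

lemma measurable_gpnn_error {d n m : ℕ} {Ω : Type*} [MeasurableSpace Ω] {c : Cov d → Cov d → ℝ}
    (hc : IsNormalizedKernel c) (θ : Hyperparameters) (hm : m ≤ n) {G : Cov d → Ω → ℝ}
    (hG : Measurable (Function.uncurry G)) :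
    Measurable fun z : Ω × (Fin n → Cov d) × (Fin n → ℝ) × Cov d =>
      gpnnPredictor c θ hm z.2.1 (fun i => G (z.2.1 i) z.1 + z.2.2.1 i) z.2.2.2 -
        G z.2.2.2 z.1 := by
  simp only [gpnnPredictor_eq_sum hc]
  refine Measurable.sub (Finset.measurable_sum _ fun j _ => Measurable.mul ?_ ?_) ?_
  · exact (measurable_nnWeights hc θ hm j).comp
      (f := fun z : Ω × (Fin n → Cov d) × (Fin n → ℝ) × Cov d => (z.2.1, z.2.2.2)) (by fun_prop)
  · refine measurable_nnIndex_comp hc θ hm (X := fun z : Ω × (Fin n → Cov d) × (Fin n → ℝ) × Cov d =>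
      z.2.1) (x := fun z => z.2.2.2) (F := fun i z => G (z.2.1 i) z.1 + z.2.2.1 i)
      (by fun_prop) (by fun_prop) (fun i => Measurable.add ?_ (by fun_prop)) j
    exact hG.comp (f := fun z : Ω × (Fin n → Cov d) × (Fin n → ℝ) × Cov d => (z.2.1 i, z.1))
      (by fun_prop)
  · exact hG.comp (f := fun z : Ω × (Fin n → Cov d) × (Fin n → ℝ) × Cov d => (z.2.2.2, z.1))
      (by fun_prop)

lemma lintegral_gpnnRisk_eq {d n m : ℕ} {Ω : Type*} [MeasurableSpace Ω] (P : Measure (Cov d))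
    [IsProbabilityMeasure P] (Pξ : Measure ℝ) [IsProbabilityMeasure Pξ] (Pw : Measure Ω)
    [IsProbabilityMeasure Pw] {c : Cov d → Cov d → ℝ}
    (hc : IsNormalizedKernel c) (θ : Hyperparameters) (hm : m ≤ n) {G : Cov d → Ω → ℝ}
    (hG : Measurable (Function.uncurry G)) :
    ∫⁻ s, gpnnRisk P Pξ c θ (fun x => G x s) hm ∂Pw =
      ∫⁻ x, ∫⁻ X, ∫⁻ s, ∫⁻ Ξ, ENNReal.ofReal
        ((gpnnPredictor c θ hm X (fun i => G (X i) s + Ξ i) x - G x s) ^ 2)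
        ∂(Measure.pi fun _ => Pξ) ∂Pw ∂(Measure.pi fun _ => P) ∂P := by
  have hmeas := measurable_gpnn_error hc θ hm hG
  rw [← lintegral_four_reorder Pw (Measure.pi fun _ : Fin n => P) (Measure.pi fun _ : Fin n => Pξ) P
    (f := fun s X Ξ x => ENNReal.ofReal
        ((gpnnPredictor c θ hm X (fun i => G (X i) s + Ξ i) x - G x s) ^ 2))
    (hmeas.pow_const 2).ennreal_ofReal]
  refine lintegral_congr fun s => ?_
  exact risk_eq_lintegral P Pξ (fun x => G x s) (gpnnPredictor c θ hm)
    (hmeas.comp (f := fun z : ((Fin n → Cov d) × (Fin n → ℝ)) × Cov d => (s, z.1.1, z.1.2, z.2))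
      (by fun_prop))

/-! ### The convergence rate for random fields that are Hölder in mean square. -/

/-- Applied with `V = m ‖w‖²`, `S = (∑ w - 1)²`, `H = h^(2p)` and `Q = h^(2α)`. Since `m` is of
order `1 / H`, `m * η` is at most of order `u²` and `V` of order `u⁴`. The power `u^8` comes from
`S`: a factor `u⁴` from `η²` and another from `V`. -/
lemma weighted_error_rate {m u V S η δ Λ E H Q D B σ : ℝ} (hm : 0 < m) (hu : 1 ≤ u) (hΛ : 0 ≤ Λ)
    (hE : 0 ≤ E) (hD : 0 ≤ D) (hB : 0 ≤ B) (hV0 : 0 ≤ V) (hη0 : 0 ≤ η) (hH : 0 < H) (hH1 : H ≤ 1)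
    (hHQ : H ≤ Q) (hV : V ≤ 2 + 2 * Λ * (m * η) ^ 2) (hS : S ≤ 2 * η ^ 2 * (1 + V))
    (hη : η ≤ E * u ^ 2 * H) (hmH : m * H ≤ 2) (hmH' : 1 ≤ 2 * (m * H)) (hδ : δ ≤ D * u ^ 2 * Q) :
    3 * (V * δ + S * B + σ ^ 2 * (V / m)) ≤
      3 * ((2 + 8 * Λ * E ^ 2) * D + 2 * E ^ 2 * (3 + 8 * Λ * E ^ 2) * B +
        2 * σ ^ 2 * (2 + 8 * Λ * E ^ 2)) * Q * u ^ 8 := by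
  have hQ : 0 < Q := hH.trans_le hHQ
  set V₀ := 2 + 8 * Λ * E ^ 2 with hV₀
  have hV₀0 : 0 ≤ V₀ := by positivity
  have hu4 : 1 ≤ u ^ 4 := one_le_pow₀ hu
  have hu2 : 1 ≤ u ^ 2 := one_le_pow₀ hu
  have hmη : m * η ≤ 2 * E * u ^ 2 := by
    calc m * η ≤ m * (E * u ^ 2 * H) := by gcongr
      _ = (m * H) * (E * u ^ 2) := by ring
      _ ≤ 2 * (E * u ^ 2) := by gcongr
      _ = _ := by ring
  have hV1 : V ≤ V₀ * u ^ 4 := by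
    calc V ≤ 2 + 2 * Λ * (m * η) ^ 2 := hV
      _ ≤ 2 * u ^ 4 + 2 * Λ * (2 * E * u ^ 2) ^ 2 := by gcongr; linarith
      _ = _ := by rw [hV₀]; ring
  have h1 : V * δ ≤ V₀ * D * Q * u ^ 8 := by
    calc V * δ ≤ V * (D * u ^ 2 * Q) := mul_le_mul_of_nonneg_left hδ hV0
      _ ≤ V₀ * u ^ 4 * (D * u ^ 2 * Q) := by gcongr
      _ = V₀ * D * Q * u ^ 6 := by ring
      _ ≤ V₀ * D * Q * u ^ 8 := by gcongr; norm_num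
  have h2 : S * B ≤ 2 * E ^ 2 * (1 + V₀) * B * Q * u ^ 8 := by
    calc S * B ≤ (2 * (E * u ^ 2 * H) ^ 2 * (u ^ 4 + V₀ * u ^ 4)) * B := by
          gcongr
          exact hS.trans (by gcongr)
      _ = 2 * E ^ 2 * (1 + V₀) * B * (H * H) * u ^ 8 := by ring
      _ ≤ 2 * E ^ 2 * (1 + V₀) * B * (1 * Q) * u ^ 8 := by gcongr
      _ = _ := by ring
  have h3 : σ ^ 2 * (V / m) ≤ 2 * σ ^ 2 * V₀ * Q * u ^ 8 := by
    have hVm : V / m ≤ V₀ * u ^ 8 * (2 * Q) := by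
      rw [div_le_iff₀ hm]
      calc V ≤ V₀ * u ^ 4 * 1 := by linarith
        _ ≤ V₀ * u ^ 8 * (2 * (m * Q)) := by
          gcongr
          · norm_num
          · exact hmH'.trans (by gcongr)
        _ = _ := by ring
    calc σ ^ 2 * (V / m) ≤ σ ^ 2 * (V₀ * u ^ 8 * (2 * Q)) := by gcongr
      _ = _ := by ring
  have h4 : 1 + V₀ = 3 + 8 * Λ * E ^ 2 := by rw [hV₀]; ring
  rw [← h4]
  linarith

/-- The constant in the risk bound, for a fixed design. -/
noncomputable def designConst (θ : Hyperparameters) (p Lc κ L B σ : ℝ) : ℝ :=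
  3 * ((2 + 8 * ((θ.noiseVar + θ.kernelScale) / θ.noiseVar) ^ 2 *
      (Lc * (θ.lengthScale⁻¹ * (2 * κ)) ^ (2 * p)) ^ 2) * (L * κ ^ 2) +
    2 * (Lc * (θ.lengthScale⁻¹ * (2 * κ)) ^ (2 * p)) ^ 2 *
      (3 + 8 * ((θ.noiseVar + θ.kernelScale) / θ.noiseVar) ^ 2 *
        (Lc * (θ.lengthScale⁻¹ * (2 * κ)) ^ (2 * p)) ^ 2) * B +
    2 * σ ^ 2 * (2 + 8 * ((θ.noiseVar + θ.kernelScale) / θ.noiseVar) ^ 2 *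
      (Lc * (θ.lengthScale⁻¹ * (2 * κ)) ^ (2 * p)) ^ 2))

lemma designConst_nonneg (θ : Hyperparameters) {p Lc κ L B σ : ℝ}
    (hL : 0 ≤ L) (hB : 0 ≤ B) : 0 ≤ designConst θ p Lc κ L B σ := by
  have := θ.kernelScale_pos
  have := θ.noiseVar_pos
  have := θ.lengthScale_pos
  unfold designConst
  positivity

/-- The risk bound for a fixed design whose `m` nearest neighbours are within `u * κ * h`. -/
lemma lintegral_sq_gpnn_error_le {d n m : ℕ} {Ω : Type*} [MeasurableSpace Ω] (Pw : Measure Ω)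
    [IsProbabilityMeasure Pw] {Pξ : Measure ℝ} {σ : ℝ} (hξ : IsNoiseLaw Pξ σ)
    {c : Cov d → Cov d → ℝ} (hc : IsNormalizedKernel c) (hiso : IsStrictlyDecreasingIsotropic c)
    {p Lc : ℝ} (hp₀ : 0 < p) (hp₁ : p ≤ 1) (hLc : 0 < Lc) (hlow : HasHolderLowerBound c Lc p)
    (θ : Hyperparameters) (hmn : m ≤ n) {G : Cov d → Ω → ℝ} (hG : ∀ x, Measurable (G x))
    {α L B : ℝ} (hα : 0 < α) (hαp : α ≤ p) (hL : 0 ≤ L) (hB0 : 0 ≤ B) {X : Fin n → Cov d}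
    {x : Cov d}
    (hδ : ∀ i, ∫⁻ s, ENNReal.ofReal ((G (X i) s - G x s) ^ 2) ∂Pw ≤
      ENNReal.ofReal (L * dist x (X i) ^ (2 * α)))
    (hB : ∫⁻ s, ENNReal.ofReal (G x s ^ 2) ∂Pw ≤ ENNReal.ofReal B)
    {κ h u : ℝ} (hκ : 1 ≤ κ) (hh : 0 < h) (hh1 : h ≤ 1) (hu : 1 ≤ u) (hm : 0 < m)
    (hmh : m * h ^ (2 * p) ≤ 2) (hmh' : 1 ≤ 2 * (m * h ^ (2 * p)))
    (hcount : m ≤ countWithin x (u * (κ * h)) X) :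
    ∫⁻ s, ∫⁻ Ξ : Fin n → ℝ, ENNReal.ofReal
        ((gpnnPredictor c θ hmn X (fun i => G (X i) s + Ξ i) x - G x s) ^ 2)
        ∂(Measure.pi fun _ => Pξ) ∂Pw ≤
      ENNReal.ofReal (designConst θ p Lc κ L B σ * h ^ (2 * α) * u ^ 8) := by
  have hℓ := θ.lengthScale_pos
  set r := u * (κ * h) with hr
  have hr0 : 0 < r := by positivity
  -- Neighbours within `r` of `x` are within `2 * r` of each other, so one `η` serves all
  -- correlations.
  set η := Lc * (θ.lengthScale⁻¹ * (2 * r)) ^ (2 * p) with hη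
  have hη0 : 0 ≤ η := by positivity
  have hdist := dist_nnIndex_le hc hiso θ hmn hcount
  have hker : ∀ y z : Cov d, dist y z ≤ 2 * r →
      1 - η ≤ c (θ.lengthScale⁻¹ • y) (θ.lengthScale⁻¹ • z) := by
    intro y z hyz
    refine le_trans ?_ (hlow _ _)
    rw [dist_smul₀, Real.norm_of_nonneg (by positivity), hη]
    gcongr
  have hx : ∀ i j, 1 - η ≤ c (θ.lengthScale⁻¹ • X (nnIndex c θ hmn X x i))
      (θ.lengthScale⁻¹ • X (nnIndex c θ hmn X x j)) := fun i j => hker _ _ <| by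
    refine (dist_triangle_left _ _ x).trans ?_
    linarith [hdist i, hdist j]
  have hxs : ∀ j, 1 - η ≤ c (θ.lengthScale⁻¹ • x)
      (θ.lengthScale⁻¹ • X (nnIndex c θ hmn X x j)) := fun j => hker _ _ <| by
    linarith [hdist j]
  set v := nnWeights c θ hmn X x with hv
  have hV := gpWeights_dotProduct_self_le hc θ hm hx hxs
  have hS := gpWeights_sum_sub_one_sq_le hc θ hm hx hxs
  change m * (v ⬝ᵥ v) ≤ _ at hV
  change (∑ j, v j - 1) ^ 2 ≤ 2 * η ^ 2 * (1 + m * (v ⬝ᵥ v)) at hS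
  have hvv : 0 ≤ v ⬝ᵥ v := by simpa using dotProduct_star_self_nonneg v
  have hm0 : (0 : ℝ) < m := by exact_mod_cast hm
  simp only [gpnnPredictor_eq_sum hc]
  refine (lintegral_sq_weighted_error_le Pw hξ hG (nnIndex_injective c θ hmn X x) v
    (δ := L * r ^ (2 * α)) (by positivity) hB0 (fun j => (hδ _).trans ?_) hB).trans ?_
  · apply ENNReal.ofReal_le_ofReal
    have := hdist j
    gcongr
  · apply ENNReal.ofReal_le_ofReal
    have hup : ∀ y : ℝ, 0 < y → y ≤ 1 → u ^ (2 * y) ≤ u ^ 2 := fun y _ hy1 => by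
      rw [← Real.rpow_natCast u 2]
      exact Real.rpow_le_rpow_of_exponent_le hu (by push_cast; linarith)
    have hκp : κ ^ (2 * α) ≤ κ ^ 2 := by
      rw [← Real.rpow_natCast κ 2]
      exact Real.rpow_le_rpow_of_exponent_le hκ (by push_cast; linarith)
    have hηle : η ≤ Lc * (θ.lengthScale⁻¹ * (2 * κ)) ^ (2 * p) * u ^ 2 * h ^ (2 * p) := by
      have : θ.lengthScale⁻¹ * (2 * r) = θ.lengthScale⁻¹ * (2 * κ) * u * h := by rw [hr]; ring
      rw [hη, this, Real.mul_rpow (by positivity) hh.le, Real.mul_rpow (by positivity)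
        (by positivity), mul_assoc Lc, mul_assoc Lc]
      have := hup p hp₀ hp₁
      gcongr
    have hδle : L * r ^ (2 * α) ≤ L * κ ^ 2 * u ^ 2 * h ^ (2 * α) := by
      rw [hr, Real.mul_rpow (by positivity) (by positivity), Real.mul_rpow (by positivity) hh.le]
      have := hup α hα (hαp.trans hp₁)
      calc L * (u ^ (2 * α) * (κ ^ (2 * α) * h ^ (2 * α))) ≤ L * (u ^ 2 * (κ ^ 2 * h ^ (2 * α))) := by
            gcongr
        _ = _ := by ring
    have hfin := weighted_error_rate (σ := σ) hm0 hu (sq_nonneg _) (by positivity) (by positivity)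
      hB0 (mul_nonneg hm0.le hvv) hη0 (Real.rpow_pos_of_pos hh (2 * p))
      (Real.rpow_le_one hh.le hh1 (by positivity))
      (Real.rpow_le_rpow_of_exponent_ge hh hh1 (by linarith : 2 * α ≤ 2 * p)) hV hS hηle hmh hmh' hδle
    rw [mul_div_cancel_left₀ _ hm0.ne'] at hfin
    exact hfin

/-- Rounding changes the value by at most 1, which is harmless up to a factor 2 once the value is at
least 2. -/
lemma IsNeighbourCount.bounds {d n m : ℕ} {p : ℝ} (hm : IsNeighbourCount d p n m)
    (hN : 2 ≤ (n : ℝ) ^ (2 * p / (2 * p + d))) :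
    (m : ℝ) ≤ 2 * (n : ℝ) ^ (2 * p / (2 * p + d)) ∧
      (n : ℝ) ^ (2 * p / (2 * p + d)) ≤ 2 * m ∧ 0 < m := by
  set N := (n : ℝ) ^ (2 * p / (2 * p + d))
  have h1 : N - 1 ≤ m ∧ (m : ℝ) ≤ N + 1 := by
    rcases hm with rfl | rfl
    · exact ⟨(Nat.sub_one_lt_floor N).le, (Nat.floor_le (by linarith)).trans (by linarith)⟩
    · exact ⟨by linarith [Nat.le_ceil N], (Nat.ceil_lt_add_one (by linarith)).le⟩
  refine ⟨by linarith, by linarith, ?_⟩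
  have : (0 : ℝ) < m := by linarith
  exact_mod_cast this

/-- The common form of both models. Mean-square regularity is required only at distances up to `R`,
which almost surely covers all pairs of test and training points. `A` and `n₀` are chosen before
kernel, field and noise. -/
theorem exists_risk_rate.{u} {d : ℕ} (hd : 0 < d) (P : Measure (Cov d)) [IsProbabilityMeasure P]
    {C : Set (Cov d)} (hC : P Cᶜ = 0) {R : ℝ}
    (hCR : ∀ x ∈ C, ∀ y ∈ C, dist x y ≤ R) {κ₀ : ℝ} (hκ₀ : 0 < κ₀)
    (hball : ∀ x ∈ C, ∀ r, 0 ≤ r → r ≤ R → κ₀ * r ^ d ≤ P.real (Metric.closedBall x r))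
    {p Lc : ℝ} (σ : ℝ) (hp₀ : 0 < p) (hp₁ : p ≤ 1) (hLc : 0 < Lc) (θ : Hyperparameters)
    {α L B : ℝ} (hα : 0 < α) (hαp : α ≤ p) (hL : 0 ≤ L) (hB : 0 ≤ B) :
    ∃ A : ℝ, 0 < A ∧ ∃ n₀ : ℕ,
      ∀ c : Cov d → Cov d → ℝ, IsNormalizedKernel c → IsStrictlyDecreasingIsotropic c →
        HasHolderLowerBound c Lc p →
      ∀ (Ω : Type u) [MeasurableSpace Ω] (Pw : Measure Ω) [IsProbabilityMeasure Pw]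
        (G : Cov d → Ω → ℝ), Measurable (Function.uncurry G) →
        (∀ x, ∫⁻ s, ENNReal.ofReal (G x s ^ 2) ∂Pw ≤ ENNReal.ofReal B) →
        (∀ x x', dist x x' ≤ R → ∫⁻ s, ENNReal.ofReal ((G x s - G x' s) ^ 2) ∂Pw ≤
          ENNReal.ofReal (L * dist x x' ^ (2 * α))) →
      ∀ Pξ : Measure ℝ, IsNoiseLaw Pξ σ →
      ∀ n m : ℕ, n₀ ≤ n → ∀ hm : m ≤ n, IsNeighbourCount d p n m →
        ∫⁻ s, gpnnRisk P Pξ c θ (fun x => G x s) hm ∂Pw ≤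
          ENNReal.ofReal (A * (n : ℝ) ^ (-(2 * α) / (2 * p + d))) := by
  have hdR : (0 : ℝ) < d := by exact_mod_cast hd
  -- The choice gives `κ₀ * κ ≥ 6`: half the expected count in a ball is then at least `3 * 2 ^ k *
  -- N`, which exceeds `m ≤ 2 * N` by at least `2 ^ k`.
  set κ : ℝ := max 1 (6 / κ₀) with hκdef
  have hκ : 1 ≤ κ := le_max_left _ _
  have hκκ₀ : 6 ≤ κ₀ * κ := by
    have := le_max_right 1 (6 / κ₀)
    rw [div_le_iff₀ hκ₀] at this
    linarith
  set A₀ := designConst θ p Lc κ L B σ with hA₀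
  have hA₀0 : 0 ≤ A₀ := designConst_nonneg θ hL hB
  set M : ℝ := 1 + 2 ^ 9 * Nat.factorial 9 with hM
  have hM0 : 0 ≤ M := by positivity
  -- The summand 1 only secures positivity of the constant; `n₀` is chosen so that `N ≥ 2`.
  refine ⟨A₀ * M + 1, by positivity, ⌈(2 : ℝ) ^ ((2 * p + d) / (2 * p))⌉₊, ?_⟩
  intro c hc hiso hlow Ω _ Pw _ G hG hGB hGL Pξ hξ n m hn hmn hnm
  have := hξ.isProbabilityMeasure
  have hn1 : (2 : ℝ) ^ ((2 * p + d) / (2 * p)) ≤ n := Nat.ceil_le.1 hn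
  have hn2 : (1 : ℝ) ≤ n := (Real.one_le_rpow one_le_two (by positivity)).trans hn1
  have hn0 : (0 : ℝ) < n := by linarith
  set N := (n : ℝ) ^ (2 * p / (2 * p + d)) with hN
  have hN2 : 2 ≤ N := by
    calc (2 : ℝ) = (2 ^ ((2 * p + d) / (2 * p))) ^ (2 * p / (2 * p + d)) := by
          rw [← Real.rpow_mul (by norm_num)]
          rw [div_mul_div_comm, mul_comm (2 * p), div_self (by positivity), Real.rpow_one]
      _ ≤ N := by rw [hN]; gcongr
  obtain ⟨hmN, hNm, hm0⟩ := hnm.bounds hN2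
  -- The scale at which `n * h ^ d` and `h ^ (-2p)` both equal `N`.
  set h := (n : ℝ) ^ (-1 / (2 * p + d)) with hh
  have hh0 : 0 < h := Real.rpow_pos_of_pos hn0 _
  have hh1 : h ≤ 1 := Real.rpow_le_one_of_one_le_of_nonpos hn2
    (div_nonpos_of_nonpos_of_nonneg (by norm_num) (by positivity))
  have hNh : N * h ^ (2 * p) = 1 := by
    rw [hN, hh, ← Real.rpow_mul hn0.le, ← Real.rpow_add hn0]
    convert Real.rpow_zero _ using 2
    ring
  have hhd : n * h ^ d = N := by
    rw [hN, hh, ← Real.rpow_natCast, ← Real.rpow_mul hn0.le]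
    nth_rewrite 1 [← Real.rpow_one (n : ℝ)]
    rw [← Real.rpow_add hn0]
    congr 1
    field_simp
    ring
  have hrate : (n : ℝ) ^ (-(2 * α) / (2 * p + d)) = h ^ (2 * α) := by
    rw [hh, ← Real.rpow_mul hn0.le]; congr 1; ring
  have hH : 0 < h ^ (2 * p) := Real.rpow_pos_of_pos hh0 _
  have hmh : m * h ^ (2 * p) ≤ 2 := by nlinarith
  have hmh' : 1 ≤ 2 * (m * h ^ (2 * p)) := by nlinarith
  have hCae : ∀ᵐ x ∂P, x ∈ C := mem_ae_iff.2 hC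
  have hs0 : 0 < κ * h := by positivity
  rw [lintegral_gpnnRisk_eq P Pξ Pw hc θ hmn hG]
  have hscale : ∀ x ∈ C, ∀ k : ℕ, (∀ᵐ y ∂P, dist x y ≤ 2 ^ k * (κ * h)) ∨
      m - n * P.real (Metric.closedBall x (2 ^ k * (κ * h))) / 2 ≤ -(2 : ℝ) ^ k := by
    intro x hx k
    rcases le_total R (2 ^ k * (κ * h)) with hk | hk
    · left
      filter_upwards [hCae] with y hy
      exact (hCR x hx y hy).trans hk
    · right
      have h1 := hball x hx _ (by positivity) hk
      -- Linear growth of the ball mass in `2 ^ k` is enough, so only `d ≥ 1` is used.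
      have h2 : 2 ^ k * κ ≤ (2 ^ k * κ) ^ d :=
        le_self_pow₀ (one_le_mul_of_one_le_of_one_le (one_le_pow₀ one_le_two) hκ) hd.ne'
      have h3 : N * (6 * 2 ^ k) ≤ n * P.real (Metric.closedBall x (2 ^ k * (κ * h))) := by
        calc N * (6 * 2 ^ k) ≤ N * (κ₀ * κ * 2 ^ k) := by gcongr
          _ = N * (κ₀ * (2 ^ k * κ)) := by ring
          _ ≤ N * (κ₀ * (2 ^ k * κ) ^ d) := by gcongr
          _ = n * (κ₀ * (2 ^ k * (κ * h)) ^ d) := by rw [← hhd]; ring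
          _ ≤ _ := by gcongr
      have h4 : (1 : ℝ) ≤ 2 ^ k := one_le_pow₀ one_le_two
      nlinarith
  have hinner : ∀ x ∈ C, ∫⁻ X, ∫⁻ s, ∫⁻ Ξ, ENNReal.ofReal
        ((gpnnPredictor c θ hmn X (fun i => G (X i) s + Ξ i) x - G x s) ^ 2)
        ∂(Measure.pi fun _ => Pξ) ∂Pw ∂(Measure.pi fun _ => P) ≤
      ENNReal.ofReal (A₀ * h ^ (2 * α)) * ENNReal.ofReal M := by
    intro x hx
    have hXC : ∀ᵐ X ∂(Measure.pi fun _ : Fin n => P), ∀ i, X i ∈ C :=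
      ae_all_iff.2 fun i =>
        (measurePreserving_eval (fun _ : Fin n => P) i).quasiMeasurePreserving.ae hCae
    calc _ ≤ ∫⁻ X, ENNReal.ofReal (A₀ * h ^ (2 * α)) * spreadFactor m (κ * h) x X
          ∂(Measure.pi fun _ : Fin n => P) := by
          refine lintegral_mono_ae ?_
          filter_upwards [hXC] with X hX
          obtain ⟨u, hu, hcount, hle⟩ := exists_scale_le_spreadFactor hmn hs0 x X
          refine (lintegral_sq_gpnn_error_le Pw hξ hc hiso hp₀ hp₁ hLc hlow θ hmn
            (G := G) (fun y => hG.comp measurable_prodMk_left) hα hαp hL hB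
            (fun i => ?_) (hGB x) hκ hh0 hh1 hu hm0 hmh hmh' hcount).trans ?_
          · rw [dist_comm]
            exact hGL _ _ (hCR _ (hX i) _ hx)
          · rw [ENNReal.ofReal_mul (by positivity)]
            gcongr
      _ = ENNReal.ofReal (A₀ * h ^ (2 * α)) *
          ∫⁻ X, spreadFactor m (κ * h) x X ∂(Measure.pi fun _ : Fin n => P) :=
          lintegral_const_mul' _ _ ENNReal.ofReal_ne_top
      _ ≤ _ := by
          gcongr
          exact lintegral_spreadFactor_le P hmn x (hscale x hx)
  calc _ ≤ ∫⁻ _x, ENNReal.ofReal (A₀ * h ^ (2 * α)) * ENNReal.ofReal M ∂P :=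
        lintegral_mono_ae (by filter_upwards [hCae] with x hx using hinner x hx)
    _ = ENNReal.ofReal (A₀ * h ^ (2 * α)) * ENNReal.ofReal M := by simp
    _ = ENNReal.ofReal (A₀ * h ^ (2 * α) * M) := (ENNReal.ofReal_mul (by positivity)).symm
    _ ≤ _ := by
        apply ENNReal.ofReal_le_ofReal
        rw [hrate]
        have : 0 < h ^ (2 * α) := Real.rpow_pos_of_pos hh0 _
        nlinarith

/-! ### Hölder functions and Gaussian fields. -/

lemma IsBoundedHolder.continuous {d : ℕ} {f : Cov d → ℝ} {B L q : ℝ}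
    (hf : IsBoundedHolder f B L q) (hq : 0 < q) : Continuous f := by
  rw [continuous_iff_continuousAt]
  intro x
  rw [ContinuousAt, tendsto_iff_dist_tendsto_zero]
  refine squeeze_zero (fun _ => dist_nonneg) (fun y => (Real.dist_eq _ _).trans_le (hf.2 y x)) ?_
  have h : Filter.Tendsto (fun y : Cov d => L * dist y x ^ q) (nhds x) (nhds (L * 0 ^ q)) := by
    have h1 : Filter.Tendsto (fun y : Cov d => dist y x) (nhds x) (nhds 0) :=
      tendsto_iff_dist_tendsto_zero.1 Filter.tendsto_id
    exact (h1.rpow_const (Or.inr hq.le)).const_mul L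
  simpa [Real.zero_rpow hq.ne'] using h

/-- Lowers a Hölder exponent to the common `α` at bounded distances: `D / R ≤ 1` reverses the order
of exponents, and `1 ≤ R` allows dropping the remaining division. -/
lemma rpow_le_mul_rpow_of_le {D R q α : ℝ} (hD : 0 ≤ D) (hDR : D ≤ R) (hR : 1 ≤ R) (hα : 0 ≤ α)
    (hαq : α ≤ q) : D ^ q ≤ R ^ q * D ^ α := by
  have hR0 : 0 < R := by linarith
  calc D ^ q = R ^ q * (D / R) ^ q := by
        rw [← Real.mul_rpow hR0.le (by positivity), mul_div_cancel₀ _ hR0.ne']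
    _ ≤ R ^ q * (D / R) ^ α := by
        have : D / R ≤ 1 := (div_le_one hR0).2 hDR
        gcongr R ^ q * ?_
        exact Real.rpow_le_rpow_of_exponent_ge' (by positivity) this hα hαq
    _ ≤ R ^ q * D ^ α := by
        gcongr
        exact div_le_self hD hR

lemma sq_le_mul_rpow_two_mul {a D K α : ℝ} (hD : 0 ≤ D) (h : |a| ≤ K * D ^ α) :
    a ^ 2 ≤ K ^ 2 * D ^ (2 * α) := by
  rw [mul_comm 2 α, Real.rpow_mul hD, ← sq_abs, Real.rpow_two, ← mul_pow]
  exact pow_le_pow_left₀ (abs_nonneg _) h 2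

lemma abs_dotProduct_le_sum {ι : Type*} [Fintype ι] {a β K : ι → ℝ} (h : ∀ i, |a i| ≤ K i) :
    |a ⬝ᵥ β| ≤ ∑ i, |β i| * K i := by
  refine (Finset.abs_sum_le_sum_abs _ _).trans (Finset.sum_le_sum fun i _ => ?_)
  rw [abs_mul, mul_comm]
  exact mul_le_mul_of_nonneg_left (h i) (abs_nonneg _)

lemma lintegral_sq_const_add_le {Ω : Type*} [MeasurableSpace Ω] (μ : Measure Ω)
    [IsProbabilityMeasure μ] {a K S : ℝ} {f : Ω → ℝ} (ha : a ^ 2 ≤ K) (hS : 0 ≤ S)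
    (hf : ∫⁻ s, ENNReal.ofReal (f s ^ 2) ∂μ ≤ ENNReal.ofReal S) :
    ∫⁻ s, ENNReal.ofReal ((a + f s) ^ 2) ∂μ ≤ ENNReal.ofReal (2 * (K + S)) := by
  have hK : 0 ≤ K := (sq_nonneg a).trans ha
  calc ∫⁻ s, ENNReal.ofReal ((a + f s) ^ 2) ∂μ
      ≤ ∫⁻ s, 2 * (ENNReal.ofReal K + ENNReal.ofReal (f s ^ 2)) ∂μ := by
        refine lintegral_mono fun s => ?_
        rw [← ENNReal.ofReal_add hK (sq_nonneg _), ← ENNReal.ofReal_ofNat,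
          ← ENNReal.ofReal_mul (by norm_num)]
        apply ENNReal.ofReal_le_ofReal
        nlinarith [sq_nonneg (a - f s)]
    _ = 2 * (ENNReal.ofReal K + ∫⁻ s, ENNReal.ofReal (f s ^ 2) ∂μ) := by
        rw [lintegral_const_mul' _ _ (by simp), lintegral_add_left measurable_const]
        simp
    _ ≤ 2 * (ENNReal.ofReal K + ENNReal.ofReal S) := by gcongr
    _ = _ := by
        rw [← ENNReal.ofReal_add hK hS, ← ENNReal.ofReal_ofNat, ← ENNReal.ofReal_mul (by norm_num)]

namespace IsCenteredGaussianField

variable {d : ℕ} {Ω : Type*} [MeasurableSpace Ω] {Pw : Measure Ω} {w : Cov d → Ω → ℝ}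
  {k : Cov d → Cov d → ℝ}

lemma memLp (hw : IsCenteredGaussianField Pw w k) (x : Cov d) : MemLp (w x) 2 Pw :=
  (hw.isGaussianProcess.hasGaussianLaw_eval x).memLp_two

lemma integral_mul (hw : IsCenteredGaussianField Pw w k) [IsProbabilityMeasure Pw] (x x' : Cov d) :
    ∫ s, w x s * w x' s ∂Pw = k x x' := by
  have h := hw.covariance_eq x x'
  rw [covariance_eq_sub (hw.memLp x) (hw.memLp x'), hw.mean_zero, zero_mul, sub_zero] at h
  exact h

lemma lintegral_sq (hw : IsCenteredGaussianField Pw w k) [IsProbabilityMeasure Pw] (x : Cov d) :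
    ∫⁻ s, ENNReal.ofReal (w x s ^ 2) ∂Pw = ENNReal.ofReal (k x x) := by
  rw [← ofReal_integral_eq_lintegral_ofReal (hw.memLp x).integrable_sq
    (ae_of_all _ fun _ => sq_nonneg _), ← hw.integral_mul x x]
  simp only [sq]

lemma lintegral_sub_sq (hw : IsCenteredGaussianField Pw w k) [IsProbabilityMeasure Pw]
    (x x' : Cov d) :
    ∫⁻ s, ENNReal.ofReal ((w x s - w x' s) ^ 2) ∂Pw =
      ENNReal.ofReal (k x x - 2 * k x x' + k x' x') := by
  have hint : ∀ y z, Integrable (fun s => w y s * w z s) Pw := fun y z =>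
    (hw.memLp y).integrable_mul (hw.memLp z)
  rw [← ofReal_integral_eq_lintegral_ofReal (f := fun s => (w x s - w x' s) ^ 2)
    ((hw.memLp x).sub (hw.memLp x')).integrable_sq
    (ae_of_all _ fun _ => sq_nonneg _), ← hw.integral_mul x x, ← hw.integral_mul x x',
    ← hw.integral_mul x' x', ← integral_const_mul, ← integral_sub (hint x x)
      ((hint x x').const_mul 2), ← integral_add
      (f := fun s => w x s * w x s - 2 * (w x s * w x' s)) ((hint x x).sub ((hint x x').const_mul 2))
      (hint x' x')]
  congr 1
  refine integral_congr_ae (ae_of_all _ fun s => ?_)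
  ring

end IsCenteredGaussianField

/-- The `NNGP` risk is a `GPnn` risk for the field of residual responses. -/
lemma nngpRisk_eq_lintegral_gpnnRisk {d n m dT : ℕ} {Ω : Type*} [MeasurableSpace Ω]
    (P : Measure (Cov d)) (Pξ : Measure ℝ) (Pw : Measure Ω) (c : Cov d → Cov d → ℝ)
    (θ : Hyperparameters) (t : Cov d → Fin dT → ℝ) (b bhat : Fin dT → ℝ) (w : Cov d → Ω → ℝ)
    (hm : m ≤ n) :
    nngpRisk P Pξ Pw c θ t b bhat w hm =
      ∫⁻ s, gpnnRisk P Pξ c θ (fun x => t x ⬝ᵥ (b - bhat) + w x s) hm ∂Pw := by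
  unfold nngpRisk gpnnRisk risk nngpPredictor gpnnPredictor
  refine lintegral_congr fun s => lintegral_congr fun Z => lintegral_congr fun x => ?_
  congr 2
  simp only [dotProduct_sub]
  simp only [sub_add_eq_add_sub]
  ring

lemma nngpExponent_bounds {dT : ℕ} {p q₀ : ℝ} {q : Fin dT → ℝ} (hp : 0 < p) (hq₀ : 0 < q₀)
    (hq : ∀ i, 0 < q i) : 0 < nngpExponent p q₀ q ∧ nngpExponent p q₀ q ≤ p ∧
      nngpExponent p q₀ q ≤ q₀ ∧ ∀ i, nngpExponent p q₀ q ≤ q i := by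
  refine ⟨lt_min hp ((Finset.lt_fold_min _).2 ⟨hq₀, fun i _ => hq i⟩), min_le_left _ _,
    (min_le_right _ _).trans ((Finset.fold_min_le _).2 (Or.inl le_rfl)), fun i =>
    (min_le_right _ _).trans ((Finset.fold_min_le _).2 (Or.inr ⟨i, Finset.mem_univ _, le_rfl⟩))⟩

end LocalGP

theorem proposition5 (d : ℕ) (hd : 0 < d) (P : Measure (Cov d)) [IsProbabilityMeasure P]
    (hP : HasSmoothPosDensityOnCompactConvex P)
    (p Lc σξ : ℝ) (hp₀ : 0 < p) (hp₁ : p ≤ 1) (hLc : 0 < Lc) (hσξ : 0 ≤ σξ)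
    (θ : Hyperparameters) :
    -- GPnn
    (∀ q Bf Lf : ℝ, 0 < q → q ≤ 1 → 1 ≤ Bf → 1 ≤ Lf →
      ∃ A : ℝ, 0 < A ∧ ∃ n₀ : ℕ,
        ∀ c : Cov d → Cov d → ℝ, IsNormalizedKernel c → IsStrictlyDecreasingIsotropic c →
          HasHolderLowerBound c Lc p →
        ∀ f : Cov d → ℝ, IsBoundedHolder f Bf Lf q →
        ∀ Pξ : Measure ℝ, IsNoiseLaw Pξ σξ →
        ∀ n m : ℕ, n₀ ≤ n → ∀ hm : m ≤ n, IsNeighbourCount d p n m →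
          gpnnRisk P Pξ c θ f hm
            ≤ ENNReal.ofReal (A * (n : ℝ) ^ (-(2 * min p q) / (2 * p + d)))) ∧
    -- NNGP
    (∀ (dT : ℕ) (q₀ : ℝ) (q L : Fin dT → ℝ) (BT Lc' σw2 : ℝ) (b bhat : Fin dT → ℝ),
      0 < q₀ → (∀ i, 0 < q i ∧ q i ≤ 1) → (∀ i, 1 ≤ L i) → 0 < Lc' → 0 < σw2 →
      ∃ A : ℝ, 0 < A ∧ ∃ n₀ : ℕ,
        ∀ c : Cov d → Cov d → ℝ, IsNormalizedKernel c → IsStrictlyDecreasingIsotropic c →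
          HasHolderLowerBound c Lc p →
        ∀ t : Cov d → Fin dT → ℝ, (∀ i, IsBoundedHolder (fun x => t x i) BT (L i) (q i)) →
        ∀ k : Cov d → Cov d → ℝ, (∀ x, k x x = σw2) →
          HasHolderLowerBound (fun x x' => k x x' / σw2) Lc' q₀ →
          EquivalentMetrics (kernelMetric c θ.lengthScale)
            (kernelMetric (fun x x' => k x x' / σw2) 1) →
        ∀ (Ω : Type*) [MeasurableSpace Ω] (Pw : Measure Ω) [IsProbabilityMeasure Pw]
          (w : Cov d → Ω → ℝ), IsCenteredGaussianField Pw w k →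
        ∀ Pξ : Measure ℝ, IsNoiseLaw Pξ σξ →
        ∀ n m : ℕ, n₀ ≤ n → ∀ hm : m ≤ n, IsNeighbourCount d p n m →
          nngpRisk P Pξ Pw c θ t b bhat w hm
            ≤ ENNReal.ofReal
                (A * (n : ℝ) ^ (-(2 * nngpExponent p q₀ q) / (2 * p + d)))) := by
  obtain ⟨C, hC, R, hR, hCR, κ₀, hκ₀, hball⟩ := hP.exists_ball_mass
  constructor
  · intro q Bf Lf hq₀ hq₁ hBf hLf
    obtain ⟨A, hA, n₀, h⟩ := exists_risk_rate hd P hC hCR hκ₀ hball σξ hp₀ hp₁ hLc θ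
      (α := min p q) (L := (Lf * R ^ q) ^ 2) (B := Bf ^ 2) (lt_min hp₀ hq₀) (min_le_left _ _)
      (by positivity) (by positivity)
    refine ⟨A, hA, n₀, fun c hc hiso hlow f hf Pξ hξ n m hn hm hnm => ?_⟩
    -- A deterministic function is a random field over a one-point probability space.
    have hmain := h c hc hiso hlow Unit (Measure.dirac ()) (fun x _ => f x)
      ((hf.continuous hq₀).measurable.comp measurable_fst) (fun x => ?_) (fun x x' hxx => ?_)
      Pξ hξ n m hn hm hnm
    · simpa using hmain
    · simp only [lintegral_const, measure_univ, mul_one]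
      apply ENNReal.ofReal_le_ofReal
      rw [← sq_abs]
      exact pow_le_pow_left₀ (abs_nonneg _) (hf.1 x) 2
    · simp only [lintegral_const, measure_univ, mul_one]
      apply ENNReal.ofReal_le_ofReal
      refine sq_le_mul_rpow_two_mul dist_nonneg ((hf.2 x x').trans ?_)
      rw [mul_assoc]
      gcongr
      exact rpow_le_mul_rpow_of_le dist_nonneg hxx hR (lt_min hp₀ hq₀).le (min_le_right _ _)
  · intro dT q₀ q L BT Lc' σw2 b bhat hq₀ hq hL hLc' hσw
    obtain ⟨hα0, hαp, hαq₀, hαq⟩ := nngpExponent_bounds hp₀ hq₀ fun i => (hq i).1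
    set α := nngpExponent p q₀ q
    set β := b - bhat
    -- A Hölder constant, with exponent `α` and at distances up to `R`, for the mean `t ⬝ᵥ β` of the
    -- residual field.
    set T := ∑ i, |β i| * (L i * R ^ q i)
    obtain ⟨A, hA, n₀, h⟩ := exists_risk_rate hd P hC hCR hκ₀ hball σξ hp₀ hp₁ hLc θ
      (α := α) (L := 2 * (T ^ 2 + 2 * σw2 * Lc' * (R ^ q₀) ^ 2))
      (B := 2 * ((∑ i, |β i| * BT) ^ 2 + σw2)) hα0 hαp
      (by positivity) (by positivity)
    refine ⟨A, hA, n₀, fun c hc hiso hlow t ht k hk hklow _ Ω _ Pw _ w hw Pξ hξ n m hn hm hnm => ?_⟩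
    rw [nngpRisk_eq_lintegral_gpnnRisk]
    have htm : Measurable fun x => t x ⬝ᵥ β := by
      simp only [dotProduct]
      exact Finset.measurable_sum _ fun i _ =>
        ((ht i).continuous (hq i).1).measurable.mul_const _
    refine h c hc hiso hlow Ω Pw (fun x s => t x ⬝ᵥ β + w x s)
      ((htm.comp measurable_fst).add hw.measurable) (fun x => ?_) (fun x x' hxx => ?_)
      Pξ hξ n m hn hm hnm
    · refine lintegral_sq_const_add_le Pw ?_ hσw.le ((hw.lintegral_sq x).trans_le (by rw [hk]))
      rw [← sq_abs]
      exact pow_le_pow_left₀ (abs_nonneg _) (abs_dotProduct_le_sum fun i => (ht i).1 x) 2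
    · have hD := dist_nonneg (x := x) (y := x')
      -- The mean-square increment of `w` is `2 * σw2` times one minus the correlation, so the lower
      -- bound on the correlation makes `w` Hölder in mean square with exponent `q₀`.
      have hwd : ∫⁻ s, ENNReal.ofReal ((w x s - w x' s) ^ 2) ∂Pw ≤
          ENNReal.ofReal (2 * σw2 * Lc' * (R ^ q₀) ^ 2 * dist x x' ^ (2 * α)) := by
        rw [hw.lintegral_sub_sq, hk, hk]
        apply ENNReal.ofReal_le_ofReal
        have h1 := hklow x x'
        simp only [le_div_iff₀ hσw] at h1
        have h2 : dist x x' ^ (2 * q₀) ≤ (R ^ q₀) ^ 2 * dist x x' ^ (2 * α) := by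
          have := rpow_le_mul_rpow_of_le hD hxx hR hα0.le hαq₀
          have h3 := sq_le_mul_rpow_two_mul (a := dist x x' ^ q₀) hD
            (by rwa [abs_of_nonneg (by positivity)])
          rwa [← Real.rpow_two, ← Real.rpow_mul hD, mul_comm q₀ 2] at h3
        have h4 : 2 * σw2 * Lc' * dist x x' ^ (2 * q₀) ≤
            2 * σw2 * Lc' * ((R ^ q₀) ^ 2 * dist x x' ^ (2 * α)) := by gcongr
        nlinarith
      have htd : (t x ⬝ᵥ β - t x' ⬝ᵥ β) ^ 2 ≤ T ^ 2 * dist x x' ^ (2 * α) := by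
        refine sq_le_mul_rpow_two_mul hD ?_
        rw [← sub_dotProduct, Finset.sum_mul]
        refine (abs_dotProduct_le_sum (K := fun i => L i * R ^ q i * dist x x' ^ α)
          fun i => ((ht i).2 x x').trans ?_).trans_eq ?_
        · rw [mul_assoc]
          have := hL i
          gcongr
          exact rpow_le_mul_rpow_of_le hD hxx hR hα0.le (hαq i)
        · exact Finset.sum_congr rfl fun i _ => by ring
      have hall := lintegral_sq_const_add_le Pw htd (by positivity) hwd
      calc _ = ∫⁻ s, ENNReal.ofReal ((t x ⬝ᵥ β - t x' ⬝ᵥ β + (w x s - w x' s)) ^ 2) ∂Pw := by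
            refine lintegral_congr fun s => ?_
            congr 2; ring
        _ ≤ _ := hall
        _ = _ := by congr 1; ring
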